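/- Let $G$ be a countable discrete sofic group with a sofic approximation $\sigma_k\colon G\to S_{d_k}$ ($k\in\mathbb N$, $d_k\ge 1$). That is, writing $u_n$ for the uniform probability measure on $\{1,\dots,n\}$, we have $u_{d_k}(\{j:\sigma_k(g)\sigma_k(h)(j)=\sigma_k(gh)(j)\})\to 1$ for all $g,h\in G$, and $u_{d_k}(\{j:\sigma_k(g)(j)\ne\sigma_k(h)(j)\})\to 1$ for all $g\neq h$ in $G$. Let $G$ act by continuous automorphisms on a compact metrizable group $X$ with normalized Haar measure $m_X$, and let $\rho$ be a compatible metric on $X$. Let $\mathrm{Prob}(\cdot)$ denote the Borel probability measures with the weak$^*$ topology. Let $\mathrm{Sub}(X)$ be the space of closed subgroups of $X$ with the Hausdorff topology. The group $G$ acts on it by $K\mapsto gK$, and $\delta_X\in\mathrm{Prob}(\mathrm{Sub}(X))$ is the point mass at $X$. A $G$-invariant random subgroup is a $G$-invariant element of $\mathrm{Prob}(\mathrm{Sub}(X))$. Elements of $A^{n}$ are identified with maps $\{1,\dots,n\}\to A$. A sequence $(\phi_k)_k$ with $\phi_k\in X^{d_k}$ is a sequence of topological microstates if, for every $g\in G$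 and every neighborhood $U$ of the diagonal in $X\times X$, $u_{d_k}(\{j:(g\phi_k(j),\phi_k(\sigma_k(g)(j)))\in U\})\to 1$ as $k\to\infty$. A sequence $\mu_k\in\mathrm{Prob}(X^{d_k})$ is asymptotically supported on topological microstates if, for every $g\in G$, every open neighborhood $U$ of the diagonal and every $\varepsilon>0$, $\mu_k(\{\phi: u_{d_k}(\{j:(\phi(\sigma_k(g)(j)),g\phi(j))\in U\})>1-\varepsilon\})\to 1$ as $k\to\infty$. A sequence $\mu_k\in\mathrm{Prob}(X^{d_k})$ locally weak$^*$ converges to $m_X$ if, for every weak$^*$ neighborhood $\mathcal O$ of $m_X$, $u_{d_k}(\{j:\mu_{k,j}\in\mathcal O\})\to1$ as $k\to\infty$, where $\mu_{k,j}$ is the $j$-th marginal of $\mu_k$. Then the following are equivalent. (i) There is no sequence $\mu_k\in\mathrm{Prob}(X^{d_k})$ which is asymptotically supported on topological microstates and locally weak$^*$ converges to $m_X$. (ii) There are a $G$-invariant random subgroup $\eta\in\mathrm{Prob}(\mathrm{Sub}(X))$ with $\eta\neq\delta_X$ and a sequence $Y_k\in\mathrm{Sub}(X)^{d_k}$ with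 the following property. For every sequence $(\phi_k)_k$ of topological microstates there is a strictly increasing sequence $(k_l)_l$ of natural numbers with $\lim_{l\to\infty}(Y_{k_l})_*(u_{d_{k_l}})=\eta$ in the weak$^*$ topology and $$\lim_{l\to\infty}\frac1{d_{k_l}}\sum_{j=1}^{d_{k_l}}\rho(\phi_{k_l}(j),Y_{k_l}(j))=0,$$ where $\rho(x,K)=\inf_{y\in K}\rho(x,y)$. -/

import Mathlib

open MeasureTheory Filter Topology

/-- The uniform probability measure `u_n` on an `n`-element set, `n ≥ 1`. -/
noncomputable def uniformProb (n : ℕ) [NeZero n] : ProbabilityMeasure (Fin n) :=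
  ⟨ProbabilityTheory.uniformOn Set.univ,
    ProbabilityTheory.isProbabilityMeasure_uniformOn Set.finite_univ Set.univ_nonempty⟩

/-- `σ k : G → Sym (d k)` is a sofic approximation of `G`: asymptotically multiplicative and
asymptotically free (the maps need not be homomorphisms). -/
structure IsSoficApproximation {G : Type*} [Group G] (d : ℕ → ℕ) [∀ k, NeZero (d k)]
    (σ : ∀ k, G → Equiv.Perm (Fin (d k))) : Prop where
  mul : ∀ g h : G,
    Tendsto (fun k => (uniformProb (d k) {j | σ k g (σ k h j) = σ k (g * h) j} : ℝ)) atTop (𝓝 1)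
  free : ∀ g h : G, g ≠ h →
    Tendsto (fun k => (uniformProb (d k) {j | σ k g j ≠ σ k h j} : ℝ)) atTop (𝓝 1)

/-- `(φ k)` is a sequence of topological microstates for `G ↷ X` with respect to `(σ k)`. -/
def IsTopMicrostates {G X : Type*} [TopologicalSpace X] [SMul G X]
    {d : ℕ → ℕ} [∀ k, NeZero (d k)] (σ : ∀ k, G → Equiv.Perm (Fin (d k)))
    (φ : ∀ k, Fin (d k) → X) : Prop :=
  ∀ U ∈ 𝓝ˢ (Set.diagonal X), ∀ g : G,
    Tendsto (fun k => (uniformProb (d k) {j | (g • φ k j, φ k (σ k g j)) ∈ U} : ℝ)) atTop (𝓝 1)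

/-- The probability measures `μ k` on `X ^ (d k)` are asymptotically supported on topological
microstates for `G ↷ X` with respect to `(σ k)`. -/
def AsympSupportedOnTopMicrostates {G X : Type*} [TopologicalSpace X] [MeasurableSpace X]
    [SMul G X] {d : ℕ → ℕ} [∀ k, NeZero (d k)] (σ : ∀ k, G → Equiv.Perm (Fin (d k)))
    (μ : ∀ k, ProbabilityMeasure (Fin (d k) → X)) : Prop :=
  ∀ g : G, ∀ U : Set (X × X), IsOpen U → Set.diagonal X ⊆ U → ∀ ε : ℝ, 0 < ε →
    Tendsto (fun k => (μ k {φ : Fin (d k) → X |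
      1 - ε < (uniformProb (d k) {j | (φ (σ k g j), g • φ j) ∈ U} : ℝ)} : ℝ)) atTop (𝓝 1)

/-- The marginal of `μ ∈ Prob (X ^ n)` on the `j`-th coordinate. -/
noncomputable def marginal {X : Type*} [MeasurableSpace X] {n : ℕ}
    (μ : ProbabilityMeasure (Fin n → X)) (j : Fin n) : ProbabilityMeasure X :=
  μ.map (f := fun x => x j) (measurable_pi_apply j).aemeasurable

/-- `μ k ∈ Prob (X ^ (d k))` locally weak-star converges to `ν ∈ Prob X`. (The topology on
`ProbabilityMeasure X` is the weak-star topology.) -/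
def LocallyWeakStarTendsto {X : Type*} [TopologicalSpace X] [MeasurableSpace X]
    [OpensMeasurableSpace X] {d : ℕ → ℕ} [∀ k, NeZero (d k)]
    (μ : ∀ k, ProbabilityMeasure (Fin (d k) → X)) (ν : ProbabilityMeasure X) : Prop :=
  ∀ O ∈ 𝓝 ν,
    Tendsto (fun k => (uniformProb (d k) {j | marginal (μ k) j ∈ O} : ℝ)) atTop (𝓝 1)

/-- The normalized Haar measure of a compact group. -/
noncomputable def haarProb (X : Type*) [Group X] [TopologicalSpace X] [IsTopologicalGroup X]
    [CompactSpace X] [MeasurableSpace X] [BorelSpace X] : ProbabilityMeasure X :=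
  ⟨Measure.haarMeasure ⊤, ⟨Measure.haarMeasure_self⟩⟩

namespace ClosedSubgroup

/-- A closed subgroup of a compact group, as a nonempty compact subset. -/
def toNonemptyCompacts {X : Type*} [Group X] [TopologicalSpace X] [CompactSpace X]
    (K : ClosedSubgroup X) : TopologicalSpace.NonemptyCompacts X :=
  ⟨⟨(K : Set X), K.isClosed'.isCompact⟩, ⟨1, one_mem K⟩⟩

/-- The Hausdorff topology on the space `Sub X` of closed subgroups of a compact group. -/
instance instHausdorffTopology {X : Type*} [Group X] [TopologicalSpace X] [CompactSpace X] :
    TopologicalSpace (ClosedSubgroup X) :=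
  TopologicalSpace.induced toNonemptyCompacts inferInstance

/-- `Sub X` carries its Borel sigma-algebra. -/
instance instBorelMeasurableSpace {X : Type*} [Group X] [TopologicalSpace X] [CompactSpace X] :
    MeasurableSpace (ClosedSubgroup X) :=
  borel (ClosedSubgroup X)

instance instBorelSpace {X : Type*} [Group X] [TopologicalSpace X] [CompactSpace X] :
    BorelSpace (ClosedSubgroup X) := ⟨rfl⟩

/-- The whole group `X`, as a point of `Sub X`. -/
def whole (X : Type*) [Group X] [TopologicalSpace X] : ClosedSubgroup X :=
  ⟨⊤, isClosed_univ⟩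

/-- The action `K ↦ g K` of `G` on `Sub X` induced by an action on `X` by continuous
automorphisms. -/
def translate {G X : Type*} [Group G] [Group X] [TopologicalSpace X]
    [MulDistribMulAction G X] [ContinuousConstSMul G X] (g : G) (K : ClosedSubgroup X) :
    ClosedSubgroup X :=
  ⟨K.toSubgroup.map (MulDistribMulAction.toMonoidHom X g),
    (Homeomorph.smul g).isClosedMap _ K.isClosed'⟩

theorem continuous_translate {G X : Type*} [Group G] [Group X] [TopologicalSpace X]
    [CompactSpace X] [MulDistribMulAction G X] [ContinuousConstSMul G X] (g : G) :
    Continuous (translate g : ClosedSubgroup X → ClosedSubgroup X) := by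
  refine continuous_induced_rng.2 ?_
  have h : (toNonemptyCompacts : ClosedSubgroup X → _) ∘ translate g =
      TopologicalSpace.NonemptyCompacts.map (fun x : X => g • x) (continuous_const_smul g) ∘
        toNonemptyCompacts := rfl
  rw [h]
  exact (continuous_const_smul g).nonemptyCompacts_map.comp continuous_induced_dom

end ClosedSubgroup

/-- `η` is a `G`-invariant random subgroup of `X`, i.e. a `G`-invariant element of
`Prob (Sub X)`. -/
def IsInvariantRandomSubgroup (G : Type*) {X : Type*} [Group G] [Group X] [TopologicalSpace X]
    [CompactSpace X] [MulDistribMulAction G X] [ContinuousConstSMul G X]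
    (η : ProbabilityMeasure (ClosedSubgroup X)) : Prop :=
  ∀ g : G, η.map (ClosedSubgroup.continuous_translate g).measurable.aemeasurable = η

/-- The point mass `δ_X` at the whole group, an element of `Prob (Sub X)`. -/
noncomputable def diracWhole (X : Type*) [Group X] [TopologicalSpace X] [CompactSpace X] :
    ProbabilityMeasure (ClosedSubgroup X) :=
  ⟨Measure.dirac (ClosedSubgroup.whole X), inferInstance⟩

/-- The empirical distribution `Y_* u_n` of `Y ∈ Ω ^ n`. -/
noncomputable def empirical {Ω : Type*} [MeasurableSpace Ω] {n : ℕ} [NeZero n]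
    (Y : Fin n → Ω) : ProbabilityMeasure Ω :=
  (uniformProb n).map (f := Y) (measurable_of_finite Y).aemeasurable

open TopologicalSpace

set_option linter.unusedSectionVars false

/-! Write M for the set of sequences with mean equivariance defect tending to zero along an
ultrafilter ω on ℕ. Continuity of the group operations makes M a group under pointwise operations
(`microstateSubgroup`), and both implications compare the values taken by M with closed subgroups of
X.

From (i) to (ii): failure of (i)'s measures at some fixed tolerance happens for infinitely many k,
and ω is chosen to live on those k. By compactness, finitely many elements of M already have value
sets almost as dense, on average over j, as those of any larger finite family
(`exists_finset_asymptotically_dense`). Since M is a group, such value sets are almost closed under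
division, hence close to closed subgroups; diagonalizing gives Y
(`exists_isAsymptoticValueSubgroup`). Every microstate sequence lies in M, so its values are close
to Y. The empirical measures of Y have an ω-limit η, invariant because Y is asymptotically
equivariant. If η were the point mass at X, finitely many elements of M would be dense in X at most
j. Long random words in them again lie in M, and at such j they are nearly Haar distributed
(`eventually_iterate_leftAverage_near_integral`); the uniform measure on these words contradicts the
choice of ω (`eventually_hasNearHaarMicrostates`).

From (ii) to the failure of existence in (i) being forced: given measures converging locally to
Haar, pick for each k an approximate microstate whose mean distance to Y is at least the expected
one, up to a vanishing error. By (ii) that expectation tends to zero along a subsequence. As most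
marginals are nearly Haar, the Haar mean distance to an η-random subgroup vanishes, so η is the
point mass at X (`eq_diracWhole_of_exists`). -/

/-- The average of a finite family of reals. -/
noncomputable def avg {n : ℕ} (f : Fin n → ℝ) : ℝ := (1 / (n : ℝ)) * ∑ j, f j

/-! ### Averages over finite sets and uniform probabilities. -/

section Averages

variable {n : ℕ}

theorem avg_mono {f g : Fin n → ℝ} (h : ∀ j, f j ≤ g j) : avg f ≤ avg g :=
  mul_le_mul_of_nonneg_left (Finset.sum_le_sum fun j _ => h j) (by positivity)

theorem avg_nonneg {f : Fin n → ℝ} (h : ∀ j, 0 ≤ f j) : 0 ≤ avg f :=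
  mul_nonneg (by positivity) (Finset.sum_nonneg fun j _ => h j)

theorem avg_add (f g : Fin n → ℝ) : avg (fun j => f j + g j) = avg f + avg g := by
  simp only [avg, Finset.sum_add_distrib, mul_add]

theorem avg_sub (f g : Fin n → ℝ) : avg (fun j => f j - g j) = avg f - avg g := by
  simp only [avg, Finset.sum_sub_distrib, mul_sub]

theorem avg_const_mul (c : ℝ) (f : Fin n → ℝ) : avg (fun j => c * f j) = c * avg f := by
  simp only [avg, ← Finset.mul_sum]; ring

theorem avg_const [NeZero n] (c : ℝ) : avg (fun _ : Fin n => c) = c := by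
  have : (n : ℝ) ≠ 0 := Nat.cast_ne_zero.2 (NeZero.ne n)
  simp only [avg, Finset.sum_const, Finset.card_univ, Fintype.card_fin, nsmul_eq_mul]
  field_simp

theorem avg_comp_perm (e : Equiv.Perm (Fin n)) (f : Fin n → ℝ) :
    avg (fun j => f (e j)) = avg f := by
  simp only [avg, Equiv.sum_comp e f]

theorem avg_finset_sum {ι : Type*} (s : Finset ι) (f : ι → Fin n → ℝ) :
    avg (fun j => ∑ i ∈ s, f i j) = ∑ i ∈ s, avg (f i) := by
  simp only [avg]
  rw [Finset.sum_comm, Finset.mul_sum]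

theorem abs_avg_le (f : Fin n → ℝ) : |avg f| ≤ avg fun j => |f j| := by
  simp only [avg, abs_mul]
  rw [abs_of_nonneg (by positivity : (0 : ℝ) ≤ 1 / (n : ℝ))]
  exact mul_le_mul_of_nonneg_left (Finset.abs_sum_le_sum_abs _ _) (by positivity)

theorem uniformProb_eq_avg [NeZero n] (s : Set (Fin n)) :
    (uniformProb n s : ℝ) = avg (s.indicator fun _ => 1) := by
  classical
  have h : (uniformProb n s : ℝ) =
      ((ProbabilityTheory.uniformOn Set.univ : Measure (Fin n)) s).toReal := rfl
  rw [h, ProbabilityTheory.uniformOn_univ, Measure.count_apply_finite _ s.toFinite,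
    avg, ENNReal.toReal_div]
  simp [Set.indicator_apply, Finset.sum_boole, div_eq_inv_mul]

/-- Markov's inequality. With `avg_le_of_uniformProb` it converts between small averages and
smallness at most indices. -/
theorem one_sub_le_uniformProb [NeZero n] {a : Fin n → ℝ} (ha : ∀ j, 0 ≤ a j) {ε : ℝ}
    (hε : 0 < ε) : 1 - avg a / ε ≤ uniformProb n {j | a j < ε} := by
  rw [uniformProb_eq_avg, div_eq_inv_mul, ← avg_const_mul]
  nth_rw 1 [← avg_const (n := n) 1]
  rw [← avg_sub]
  refine avg_mono fun j => ?_
  have h0 : 0 ≤ ε⁻¹ * a j := mul_nonneg (inv_nonneg.2 hε.le) (ha j)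
  by_cases h : a j < ε
  · rw [Set.indicator_of_mem (by exact h)]; linarith
  · rw [Set.indicator_of_notMem (by exact h)]
    have : 1 ≤ ε⁻¹ * a j := by
      rw [← div_eq_inv_mul, one_le_div hε]; exact not_lt.1 h
    linarith

theorem avg_le_of_uniformProb [NeZero n] {a : Fin n → ℝ} {ε C : ℝ} {s : Set (Fin n)}
    (hs : ∀ j ∈ s, a j ≤ ε) (hC : ∀ j, a j ≤ C + ε) :
    avg a ≤ ε + C * (1 - uniformProb n s) := by
  have h : ε + C * (1 - avg (s.indicator fun _ => (1 : ℝ))) =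
      avg fun j => ε + C * (1 - s.indicator (fun _ => (1 : ℝ)) j) := by
    rw [avg_add, avg_const_mul, avg_sub, avg_const, avg_const]
  rw [uniformProb_eq_avg, h]
  refine avg_mono fun j => ?_
  by_cases h : j ∈ s
  · rw [Set.indicator_of_mem h]; simpa using hs j h
  · rw [Set.indicator_of_notMem h]; have := hC j; simp; linarith

theorem uniformProb_mono [NeZero n] {s t : Set (Fin n)} (h : s ⊆ t) :
    (uniformProb n s : ℝ) ≤ uniformProb n t :=
  NNReal.coe_le_coe.2 ((uniformProb n).apply_mono h)

theorem integral_empirical {Ω : Type*} [MeasurableSpace Ω] [NeZero n] (Y : Fin n → Ω)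
    {f : Ω → ℝ} (hf : StronglyMeasurable f) :
    ∫ x, f x ∂(empirical Y : Measure Ω) = avg fun j => f (Y j) := by
  have h : (empirical Y : Measure Ω) =
      (ProbabilityTheory.uniformOn Set.univ : Measure (Fin n)).map Y := rfl
  rw [h, integral_map (measurable_of_finite Y).aemeasurable hf.aestronglyMeasurable,
    integral_fintype (Integrable.of_finite)]
  simp only [avg, Finset.mul_sum, smul_eq_mul]
  refine Finset.sum_congr rfl fun j _ => ?_
  congr 1
  rw [measureReal_def, ProbabilityTheory.uniformOn_univ, Measure.count_singleton,
    ENNReal.toReal_div]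
  simp

end Averages

/-! ### Compactness estimates and limits along filters. -/

section Compactness

/-- If `v ≤ 0` wherever the nonnegative function `u` vanishes, then `v` is bounded by
`ε + C u` on a compact set. -/
theorem IsCompact.exists_le_add_mul {α : Type*} [TopologicalSpace α] {K : Set α}
    (hK : IsCompact K) {u v : α → ℝ} (hu : Continuous u) (hv : Continuous v)
    (hu0 : ∀ x ∈ K, 0 ≤ u x) (huv : ∀ x ∈ K, u x = 0 → v x ≤ 0) {ε : ℝ} (hε : 0 < ε) :
    ∃ C, 0 ≤ C ∧ ∀ x ∈ K, v x ≤ ε + C * u x := by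
  have hK' : IsCompact (K ∩ {x | ε ≤ v x}) := hK.inter_right (isClosed_le continuous_const hv)
  rcases (K ∩ {x | ε ≤ v x}).eq_empty_or_nonempty with he | hne
  · refine ⟨0, le_rfl, fun x hx => ?_⟩
    have : ¬ ε ≤ v x := fun h => (he ▸ (⟨hx, h⟩ : x ∈ K ∩ {x | ε ≤ v x}) : x ∈ (∅ : Set α))
    linarith
  · obtain ⟨a, ha, hamin⟩ := hK'.exists_isMinOn hne hu.continuousOn
    obtain ⟨b, hb, hbmax⟩ := hK'.exists_isMaxOn hne hv.continuousOn
    have ha0 : 0 < u a := by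
      refine lt_of_le_of_ne (hu0 a ha.1) fun h => ?_
      have := huv a ha.1 h.symm
      have := ha.2
      simp only [Set.mem_ofPred_eq] at this
      linarith
    have hb0 : 0 < v b := lt_of_lt_of_le hε hb.2
    -- On the compact set where `ε ≤ v`, `u` is at least `u a > 0` and `v` is at most `v b`.
    refine ⟨v b / u a, by positivity, fun x hx => ?_⟩
    have hux := hu0 x hx
    by_cases h : ε ≤ v x
    · have h1 : u a ≤ u x := hamin ⟨hx, h⟩
      have h2 : v x ≤ v b := hbmax ⟨hx, h⟩
      have h3 : v b ≤ v b / u a * u x := by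
        rw [div_mul_eq_mul_div, le_div_iff₀ ha0]
        exact mul_le_mul_of_nonneg_left h1 hb0.le
      linarith
    · have : 0 ≤ v b / u a * u x := by positivity
      linarith

/-- Stands in for a Lipschitz bound. Being affine in the distance, it survives averaging over j,
with a constant independent of k. -/
theorem Continuous.exists_dist_le_add_mul {α β : Type*} [MetricSpace α] [CompactSpace α]
    [MetricSpace β] {f : α → β} (hf : Continuous f) {ε : ℝ} (hε : 0 < ε) :
    ∃ C, 0 ≤ C ∧ ∀ x y, dist (f x) (f y) ≤ ε + C * dist x y := by
  obtain ⟨C, hC, h⟩ := (isCompact_univ : IsCompact (Set.univ : Set (α × α))).exists_le_add_mul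
    (u := fun p => dist p.1 p.2) (v := fun p => dist (f p.1) (f p.2))
    (by fun_prop) (by fun_prop) (fun _ _ => dist_nonneg)
    (fun p _ hp => by rw [dist_eq_zero.1 hp, dist_self]) hε
  exact ⟨C, hC, fun x y => h (x, y) trivial⟩

theorem tendsto_zero_of_le_add_mul {ι : Type*} {l : Filter ι} {u v : ι → ℝ} (hv : ∀ k, 0 ≤ v k)
    (h : ∀ ε : ℝ, 0 < ε → ∃ C, 0 ≤ C ∧ ∀ᶠ k in l, v k ≤ ε + C * u k)
    (hu : Tendsto u l (𝓝 0)) : Tendsto v l (𝓝 0) := by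
  rw [Metric.tendsto_nhds]
  intro ε hε
  obtain ⟨C, hC, hle⟩ := h (ε / 2) (by positivity)
  have h1 : Tendsto (fun k => C * u k) l (𝓝 (C * 0)) := hu.const_mul C
  rw [mul_zero] at h1
  filter_upwards [hle, h1.eventually (gt_mem_nhds (half_pos hε))] with k hk1 hk2
  rw [Real.dist_eq, sub_zero, abs_of_nonneg (hv k)]
  linarith

theorem tendsto_avg_zero_of_le_add_mul {d : ℕ → ℕ} [∀ k, NeZero (d k)] {l : Filter ℕ}
    {u v : ∀ k, Fin (d k) → ℝ} (hv : ∀ k j, 0 ≤ v k j)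
    (h : ∀ ε : ℝ, 0 < ε → ∃ C, 0 ≤ C ∧ ∀ k j, v k j ≤ ε + C * u k j)
    (hu : Tendsto (fun k => avg (u k)) l (𝓝 0)) : Tendsto (fun k => avg (v k)) l (𝓝 0) := by
  refine tendsto_zero_of_le_add_mul (fun k => avg_nonneg (hv k)) (fun ε hε => ?_) hu
  obtain ⟨C, hC, hle⟩ := h ε hε
  refine ⟨C, hC, Eventually.of_forall fun k => ?_⟩
  calc avg (v k) ≤ avg (fun j => ε + C * u k j) := avg_mono (hle k)
    _ = ε + C * avg (u k) := by rw [avg_add, avg_const, avg_const_mul]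

theorem half_add_mul_lt {ε C : ℝ} (hε : 0 < ε) (hC : 0 ≤ C) :
    ε / 2 + C * (ε / (2 * (C + 1))) < ε := by
  have h1 : C * (ε / (2 * (C + 1))) = (ε / 2) * (C / (C + 1)) := by field_simp
  have h2 : C / (C + 1) < 1 := by rw [div_lt_one (by positivity)]; linarith
  have h3 : (ε / 2) * (C / (C + 1)) < ε / 2 * 1 := by gcongr
  linarith

theorem tendsto_avg_zero_of_tendsto_uniformProb {d : ℕ → ℕ} [∀ k, NeZero (d k)] {l : Filter ℕ}
    {a : ∀ k, Fin (d k) → ℝ} {D : ℝ} (h0 : ∀ k j, 0 ≤ a k j) (hD : ∀ k j, a k j ≤ D)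
    (h : ∀ ε : ℝ, 0 < ε →
      Tendsto (fun k => (uniformProb (d k) {j | a k j < ε} : ℝ)) l (𝓝 1)) :
    Tendsto (fun k => avg (a k)) l (𝓝 0) := by
  rw [Metric.tendsto_nhds]
  intro ε hε
  have h1 : Tendsto (fun k => ε / 2 + D * (1 - (uniformProb (d k) {j | a k j < ε / 2} : ℝ))) l
      (𝓝 (ε / 2 + D * (1 - 1))) :=
    ((tendsto_const_nhds.sub (h _ (half_pos hε))).const_mul D).const_add _
  filter_upwards [h1.eventually (gt_mem_nhds (by linarith : ε / 2 + D * (1 - 1) < ε))] with k hk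
  rw [Real.dist_eq, sub_zero, abs_of_nonneg (avg_nonneg (h0 k))]
  exact (avg_le_of_uniformProb (fun j hj => le_of_lt hj)
    fun j => (hD k j).trans (by linarith)).trans_lt hk

theorem exists_dist_le (X : Type*) [MetricSpace X] [CompactSpace X] :
    ∃ D, 0 < D ∧ ∀ x y : X, dist x y ≤ D := by
  obtain ⟨D, hD⟩ := Metric.isBounded_iff.1 (isCompact_univ : IsCompact (Set.univ : Set X)).isBounded
  exact ⟨max D 1, by positivity, fun x y => (hD trivial trivial).trans (le_max_left _ _)⟩

/-- Diagonalization along a filter finer than `atTop`. -/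
theorem exists_tendsto_eventually_diagonal {l : Filter ℕ} (hl : l ≤ atTop) {p : ℕ → ℕ → Prop}
    (h : ∀ n, ∀ᶠ k in l, p n k) :
    ∃ N : ℕ → ℕ, Tendsto N l atTop ∧ ∀ᶠ k in l, p (N k) k := by
  classical
  refine ⟨fun k => Nat.findGreatest (fun m => p m k) k, ?_, ?_⟩
  · refine tendsto_atTop.2 fun n => ?_
    filter_upwards [h n, hl (eventually_ge_atTop n)] with k hk hnk
    exact Nat.le_findGreatest hnk hk
  -- `Nat.findGreatest` returns 0 when no index up to `k` works, so `p 0 k` is what guarantees that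
  -- the chosen index is valid.
  · filter_upwards [h 0] with k hk
    exact Nat.findGreatest_spec (P := fun m => p m k) (Nat.zero_le k) hk

theorem Ultrafilter.exists_tendsto_of_mem_Icc (ω : Ultrafilter ℕ) {u : ℕ → ℝ} {a b : ℝ}
    (h : ∀ k, u k ∈ Set.Icc a b) : ∃ c ∈ Set.Icc a b, Tendsto u ω (𝓝 c) :=
  isCompact_Icc.ultrafilter_le_nhds (ω.map u)
    (le_principal_iff.2 (Filter.mem_map.2 (Eventually.of_forall h)))

end Compactness

/-! ### The Hausdorff metric and mean distance to a compact set. -/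

section Hyperspace

variable {X : Type*} [MetricSpace X]

theorem NonemptyCompacts.infDist_le_infDist_add_dist (x : X) (A B : NonemptyCompacts X) :
    Metric.infDist x A ≤ Metric.infDist x B + dist A B := by
  have := (Metric.lipschitz_infDist_set x).dist_le_mul A B
  rw [Real.dist_eq, NNReal.coe_one, one_mul] at this
  linarith [le_abs_self (Metric.infDist x (A : Set X) - Metric.infDist x B)]

theorem NonemptyCompacts.infDist_le_dist_of_mem {x : X} {A B : NonemptyCompacts X} (hx : x ∈ A) :
    Metric.infDist x B ≤ dist A B := by
  have := NonemptyCompacts.infDist_le_infDist_add_dist x B A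
  rwa [Metric.infDist_zero_of_mem (show x ∈ (A : Set X) from hx), zero_add, dist_comm] at this

theorem NonemptyCompacts.continuous_infDist (x : X) :
    Continuous fun A : NonemptyCompacts X => Metric.infDist x A :=
  (Metric.lipschitz_infDist_set x).continuous

theorem NonemptyCompacts.isClosed_setOf_le :
    IsClosed {p : NonemptyCompacts X × NonemptyCompacts X | (p.1 : Set X) ⊆ p.2} := by
  have h : {p : NonemptyCompacts X × NonemptyCompacts X | (p.1 : Set X) ⊆ p.2} =
      {p | p.1 ⊔ p.2 = p.2} := by
    ext p
    exact (sup_eq_right (a := p.1) (b := p.2)).symm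
  rw [h]
  exact isClosed_eq (continuous_fst.sup continuous_snd) continuous_snd

variable [CompactSpace X] [MeasurableSpace X] [BorelSpace X]

/-- The mean distance of a `ν`-random point to the compact set `A`. -/
noncomputable def meanDist (ν : Measure X) (A : NonemptyCompacts X) : ℝ :=
  ∫ x, Metric.infDist x A ∂ν

theorem integrable_of_continuous (ν : Measure X) [IsFiniteMeasure ν] {f : X → ℝ}
    (hf : Continuous f) : Integrable f ν :=
  hf.integrable_of_hasCompactSupport (HasCompactSupport.of_compactSpace f)

theorem meanDist_nonneg (ν : Measure X) (A : NonemptyCompacts X) : 0 ≤ meanDist ν A :=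
  integral_nonneg fun _ => Metric.infDist_nonneg

theorem meanDist_le_add_dist (ν : Measure X) [IsProbabilityMeasure ν] (A B : NonemptyCompacts X) :
    meanDist ν A ≤ meanDist ν B + dist A B := by
  have hB := integrable_of_continuous ν (Metric.continuous_infDist_pt (B : Set X))
  calc meanDist ν A ≤ ∫ x, (Metric.infDist x B + dist A B) ∂ν :=
        integral_mono (integrable_of_continuous ν (Metric.continuous_infDist_pt (A : Set X)))
          (hB.add (integrable_const _))
          fun x => NonemptyCompacts.infDist_le_infDist_add_dist x A B
    _ = meanDist ν B + dist A B := by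
        rw [integral_add hB (integrable_const _)]; simp [meanDist]

theorem continuous_meanDist (ν : Measure X) [IsProbabilityMeasure ν] :
    Continuous (meanDist ν) :=
  (LipschitzWith.of_le_add (meanDist_le_add_dist ν)).continuous

theorem meanDist_le_of_dist_le (ν : Measure X) [IsProbabilityMeasure ν] {D : ℝ}
    (hD : ∀ x y : X, dist x y ≤ D) (A : NonemptyCompacts X) : meanDist ν A ≤ D := by
  calc meanDist ν A ≤ ∫ _, D ∂ν := by
        refine integral_mono (integrable_of_continuous ν (Metric.continuous_infDist_pt (A : Set X)))
          (integrable_const _) fun x => ?_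
        obtain ⟨a, ha⟩ := A.nonempty
        exact (Metric.infDist_le_dist_of_mem ha).trans (hD x a)
    _ = D := by simp

/-- For a measure of full support, the mean distance is strictly antitone. -/
theorem eq_of_meanDist_le (ν : Measure X) [IsProbabilityMeasure ν] [ν.IsOpenPosMeasure]
    {A B : NonemptyCompacts X} (hAB : (A : Set X) ⊆ B) (h : meanDist ν A ≤ meanDist ν B) :
    A = B := by
  refine SetLike.coe_injective (hAB.antisymm fun x hx => ?_)
  by_contra hxA
  have hA := Metric.continuous_infDist_pt (A : Set X)
  have hB := Metric.continuous_infDist_pt (B : Set X)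
  have hpos : 0 < ∫ y, (Metric.infDist y A - Metric.infDist y B) ∂ν := by
    refine (hA.sub hB).integral_pos_of_hasCompactSupport_nonneg_nonzero (x := x)
      (HasCompactSupport.of_compactSpace _)
      (fun y => sub_nonneg.2 (Metric.infDist_le_infDist_of_subset hAB A.nonempty)) ?_
    rw [Metric.infDist_zero_of_mem hx, sub_zero]
    exact ((A.isCompact.isClosed.notMem_iff_infDist_pos A.nonempty).1 hxA).ne'
  rw [integral_sub (integrable_of_continuous ν hA) (integrable_of_continuous ν hB)] at hpos
  exact absurd h (not_le.2 (sub_pos.1 hpos))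

/-- Quantitative form of `eq_of_meanDist_le`: nested pairs form a compact set, on which equality of
mean distances forces A = B. It reduces Hausdorff closeness of nested sets to one monotone real
quantity. -/
theorem exists_dist_le_add_mul_meanDist_sub (ν : Measure X) [IsProbabilityMeasure ν]
    [ν.IsOpenPosMeasure] {ε : ℝ} (hε : 0 < ε) :
    ∃ C, 0 ≤ C ∧ ∀ A B : NonemptyCompacts X, (A : Set X) ⊆ B →
      dist A B ≤ ε + C * (meanDist ν A - meanDist ν B) := by
  have hc := continuous_meanDist (X := X) ν
  have hmono : ∀ A B : NonemptyCompacts X, (A : Set X) ⊆ B → meanDist ν B ≤ meanDist ν A :=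
    fun A B h => integral_mono
      (integrable_of_continuous ν (Metric.continuous_infDist_pt (B : Set X)))
      (integrable_of_continuous ν (Metric.continuous_infDist_pt (A : Set X)))
      fun y => Metric.infDist_le_infDist_of_subset h A.nonempty
  obtain ⟨C, hC, h⟩ := (NonemptyCompacts.isClosed_setOf_le (X := X)).isCompact.exists_le_add_mul
    (u := fun p => meanDist ν p.1 - meanDist ν p.2) (v := fun p => dist p.1 p.2)
    ((hc.comp continuous_fst).sub (hc.comp continuous_snd)) (by fun_prop)
    (fun p hp => sub_nonneg.2 (hmono _ _ hp))
    (fun p hp h0 => by rw [eq_of_meanDist_le ν hp (sub_eq_zero.1 h0).le, dist_self]) hε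
  exact ⟨C, hC, fun A B hAB => h (A, B) hAB⟩

end Hyperspace

/-! ### The compact space of closed subgroups. -/

namespace ClosedSubgroup

variable {X : Type*} [Group X] [MetricSpace X] [CompactSpace X]

theorem toNonemptyCompacts_injective :
    Function.Injective (toNonemptyCompacts : ClosedSubgroup X → NonemptyCompacts X) :=
  fun A B h => SetLike.coe_injective
    (show (toNonemptyCompacts A : Set X) = toNonemptyCompacts B by rw [h])

/-- The Hausdorff metric on closed subgroups. -/
noncomputable instance instMetricSpace : MetricSpace (ClosedSubgroup X) :=
  MetricSpace.induced toNonemptyCompacts toNonemptyCompacts_injective inferInstance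

theorem continuous_toNonemptyCompacts :
    Continuous (toNonemptyCompacts : ClosedSubgroup X → NonemptyCompacts X) :=
  continuous_induced_dom

variable [IsTopologicalGroup X]

/-- The compact set of quotients `a / b` with `a, b ∈ A`. -/
def quotients (A : NonemptyCompacts X) : NonemptyCompacts X :=
  (A ×ˢ A).map (fun p : X × X => p.1 / p.2) continuous_div'

theorem coe_quotients (A : NonemptyCompacts X) :
    (quotients A : Set X) = (fun p : X × X => p.1 / p.2) '' ((A : Set X) ×ˢ (A : Set X)) := by
  rw [quotients, NonemptyCompacts.coe_map, NonemptyCompacts.coe_prod]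

theorem continuous_quotients : Continuous (quotients : NonemptyCompacts X → _) :=
  (continuous_div'.nonemptyCompacts_map).comp
    (NonemptyCompacts.continuous_prod.comp (continuous_id.prodMk continuous_id))

theorem exists_eq_of_quotients_subset {A : NonemptyCompacts X} (h1 : (1 : X) ∈ A)
    (h : (quotients A : Set X) ⊆ A) : ∃ K : ClosedSubgroup X, toNonemptyCompacts K = A := by
  have hdiv : ∀ a ∈ A, ∀ b ∈ A, a / b ∈ A := fun a ha b hb =>
    h (by rw [coe_quotients]; exact ⟨(a, b), ⟨ha, hb⟩, rfl⟩)
  have hinv : ∀ b ∈ A, b⁻¹ ∈ A := fun b hb => by simpa using hdiv 1 h1 b hb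
  exact ⟨⟨{ carrier := A, one_mem' := h1, inv_mem' := fun {b} hb => hinv b hb
            mul_mem' := fun {a b} ha hb => by simpa using hdiv a ha _ (hinv b hb) },
    A.isCompact.isClosed⟩, rfl⟩

/-- A compact set is a subgroup exactly when it contains 1 and its quotients, and both conditions
are closed in the Hausdorff metric. Compactness of the space of closed subgroups follows. -/
theorem isClosed_range_toNonemptyCompacts :
    IsClosed (Set.range (toNonemptyCompacts : ClosedSubgroup X → NonemptyCompacts X)) := by
  have h : Set.range (toNonemptyCompacts : ClosedSubgroup X → NonemptyCompacts X) =
      {A : NonemptyCompacts X | Metric.infDist (1 : X) A = 0} ∩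
        {A : NonemptyCompacts X | (quotients A : Set X) ⊆ A} := by
    ext A
    constructor
    · rintro ⟨K, rfl⟩
      refine ⟨Metric.infDist_zero_of_mem (one_mem K), ?_⟩
      change (quotients (toNonemptyCompacts K) : Set X) ⊆ _
      rw [coe_quotients]
      rintro _ ⟨p, hp, rfl⟩
      exact div_mem (S := ClosedSubgroup X) hp.1 hp.2
    · rintro ⟨h1, h2⟩
      exact exists_eq_of_quotients_subset
        ((A.isCompact.isClosed.mem_iff_infDist_zero A.nonempty).2 h1) h2
  rw [h]
  exact (isClosed_eq (NonemptyCompacts.continuous_infDist 1) continuous_const).inter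
    (NonemptyCompacts.isClosed_setOf_le.preimage (continuous_quotients.prodMk continuous_id))

instance instCompactSpace : CompactSpace (ClosedSubgroup X) := by
  have h : Topology.IsClosedEmbedding
      (toNonemptyCompacts : ClosedSubgroup X → NonemptyCompacts X) :=
    ⟨⟨⟨rfl⟩, toNonemptyCompacts_injective⟩, isClosed_range_toNonemptyCompacts⟩
  exact h.compactSpace

theorem exists_nearest (A : NonemptyCompacts X) : ∃ K : ClosedSubgroup X,
    dist A (toNonemptyCompacts K) = Metric.infDist A (Set.range (toNonemptyCompacts (X := X))) := by
  obtain ⟨_, ⟨K, rfl⟩, hK⟩ :=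
    (isClosed_range_toNonemptyCompacts (X := X)).isCompact.exists_infDist_eq_dist
      ⟨_, whole X, rfl⟩ A
  exact ⟨K, hK.symm⟩

/-- A closed subgroup nearest to `A` in the Hausdorff metric. -/
noncomputable def nearest (A : NonemptyCompacts X) : ClosedSubgroup X :=
  (exists_nearest A).choose

theorem dist_nearest_le (A : NonemptyCompacts X) (K : ClosedSubgroup X) :
    dist A (toNonemptyCompacts (nearest A)) ≤ dist A (toNonemptyCompacts K) := by
  rw [nearest, (exists_nearest A).choose_spec]
  exact Metric.infDist_le_dist_of_mem ⟨K, rfl⟩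

/-- Stability of being a subgroup: if the quotients of A lie in a set B near A, then A is near a
subgroup. In the limiting case A = B, the set A is itself a subgroup, and compactness does the rest.
-/
theorem exists_dist_nearest_le_add_mul {ε : ℝ} (hε : 0 < ε) :
    ∃ C, 0 ≤ C ∧ ∀ A B : NonemptyCompacts X, (1 : X) ∈ A → (quotients A : Set X) ⊆ B →
      dist A (toNonemptyCompacts (nearest A)) ≤ ε + C * dist A B := by
  have hcl : IsClosed {p : NonemptyCompacts X × NonemptyCompacts X |
      Metric.infDist (1 : X) p.1 = 0 ∧ (quotients p.1 : Set X) ⊆ p.2} :=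
    (isClosed_eq ((NonemptyCompacts.continuous_infDist 1).comp continuous_fst)
      continuous_const).inter (NonemptyCompacts.isClosed_setOf_le.preimage
        ((continuous_quotients.comp continuous_fst).prodMk continuous_snd))
  obtain ⟨C, hC, h⟩ := hcl.isCompact.exists_le_add_mul
    (u := fun p => dist p.1 p.2)
    (v := fun p => Metric.infDist p.1 (Set.range (toNonemptyCompacts (X := X))))
    (by fun_prop) ((Metric.continuous_infDist_pt _).comp continuous_fst)
    (fun p _ => dist_nonneg) (fun p hp h0 => by
      obtain ⟨A, B⟩ := p
      obtain rfl : A = B := dist_eq_zero.1 h0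
      obtain ⟨K, hK⟩ := exists_eq_of_quotients_subset
        ((A.isCompact.isClosed.mem_iff_infDist_zero A.nonempty).2 hp.1) hp.2
      exact (Metric.infDist_zero_of_mem (Set.mem_range.2 ⟨K, hK⟩)).le) hε
  refine ⟨C, hC, fun A B h1 h2 => ?_⟩
  rw [nearest, (exists_nearest A).choose_spec]
  have hmem : Metric.infDist (1 : X) A = 0 ∧ (quotients A : Set X) ⊆ B :=
    ⟨Metric.infDist_zero_of_mem h1, h2⟩
  exact h (A, B) hmem

end ClosedSubgroup

/-! ### Microstates in terms of mean equivariance defect. -/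

section Microstates

variable {G X : Type*} [Group G] [Group X] [MetricSpace X] [CompactSpace X]
  [MulDistribMulAction G X] [ContinuousConstSMul G X]
  {d : ℕ → ℕ} [∀ k, NeZero (d k)] (σ : ∀ k, G → Equiv.Perm (Fin (d k)))

/-- The mean defect of equivariance of `φ : X ^ (d k)` at `g`. -/
noncomputable def equivarianceDefect (g : G) (k : ℕ) (φ : Fin (d k) → X) : ℝ :=
  avg fun j => dist (g • φ j) (φ (σ k g j))

theorem equivarianceDefect_nonneg (g : G) (k : ℕ) (φ : Fin (d k) → X) :
    0 ≤ equivarianceDefect σ g k φ := avg_nonneg fun _ => dist_nonneg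

theorem continuous_equivarianceDefect (g : G) (k : ℕ) :
    Continuous (equivarianceDefect (X := X) σ g k) := by
  unfold equivarianceDefect avg
  fun_prop

theorem exists_dist_lt_of_mem_nhdsSet_diagonal {U : Set (X × X)}
    (hU : U ∈ 𝓝ˢ (Set.diagonal X)) : ∃ δ > 0, ∀ x y : X, dist x y < δ → (x, y) ∈ U := by
  rw [nhdsSet_diagonal_eq_uniformity, Metric.mem_uniformity_dist] at hU
  obtain ⟨δ, hδ, h⟩ := hU
  exact ⟨δ, hδ, fun x y hxy => h hxy⟩

theorem isTopMicrostates_of_tendsto_defect {φ : ∀ k, Fin (d k) → X}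
    (h : ∀ g : G, Tendsto (fun k => equivarianceDefect σ g k (φ k)) atTop (𝓝 0)) :
    IsTopMicrostates σ φ := by
  intro U hU g
  obtain ⟨δ, hδ, hδU⟩ := exists_dist_lt_of_mem_nhdsSet_diagonal hU
  have h1 : Tendsto (fun k => 1 - equivarianceDefect σ g k (φ k) / δ) atTop (𝓝 (1 - 0 / δ)) :=
    tendsto_const_nhds.sub ((h g).div_const δ)
  rw [zero_div, sub_zero] at h1
  refine tendsto_of_tendsto_of_tendsto_of_le_of_le h1 tendsto_const_nhds (fun k => ?_)
    fun k => NNReal.coe_le_coe.2 (ProbabilityMeasure.apply_le_one _ _)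
  exact (one_sub_le_uniformProb (fun _ => dist_nonneg) hδ).trans
    (uniformProb_mono fun j hj => hδU _ _ hj)

theorem IsTopMicrostates.tendsto_defect {φ : ∀ k, Fin (d k) → X} (h : IsTopMicrostates σ φ)
    (g : G) : Tendsto (fun k => equivarianceDefect σ g k (φ k)) atTop (𝓝 0) := by
  obtain ⟨D, hD0, hD⟩ := exists_dist_le X
  refine tendsto_avg_zero_of_tendsto_uniformProb (fun _ _ => dist_nonneg) (fun _ _ => hD _ _)
    fun ε hε => h {p | dist p.1 p.2 < ε} ?_ g
  rw [nhdsSet_diagonal_eq_uniformity]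
  exact Metric.dist_mem_uniformity hε

/-- The group of sequences of microstates along the filter `l`. -/
def microstateSubgroup [IsTopologicalGroup X] (l : Filter ℕ) :
    Subgroup (∀ k, Fin (d k) → X) where
  carrier := {s | ∀ g : G, Tendsto (fun k => equivarianceDefect σ g k (s k)) l (𝓝 0)}
  one_mem' g := by
    simp only [equivarianceDefect, Pi.one_apply, smul_one, dist_self, avg_const]
    exact tendsto_const_nhds
  mul_mem' {s t} hs ht g := by
    have hst := (hs g).add (ht g)
    simp only [equivarianceDefect, ← avg_add, add_zero] at hst
    -- Uniform continuity of multiplication bounds the defect of a product by the sum of the two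
    -- defects.
    refine tendsto_avg_zero_of_le_add_mul (fun _ _ => dist_nonneg) (fun ε hε => ?_) hst
    obtain ⟨C, hC, h⟩ :=
      (continuous_fst.mul continuous_snd :
        Continuous fun p : X × X => p.1 * p.2).exists_dist_le_add_mul hε
    refine ⟨C, hC, fun k j => ?_⟩
    have h1 := h (g • s k j, g • t k j) (s k (σ k g j), t k (σ k g j))
    simp only [Pi.mul_apply, smul_mul']
    refine h1.trans ?_
    gcongr
    rw [Prod.dist_eq]
    exact max_le_add_of_nonneg dist_nonneg dist_nonneg
  inv_mem' {s} hs g := by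
    refine tendsto_avg_zero_of_le_add_mul (fun _ _ => dist_nonneg) (fun ε hε => ?_) (hs g)
    obtain ⟨C, hC, h⟩ := (continuous_inv : Continuous fun x : X => x⁻¹).exists_dist_le_add_mul hε
    refine ⟨C, hC, fun k j => ?_⟩
    simpa only [Pi.inv_apply, smul_inv'] using h (g • s k j) (s k (σ k g j))

end Microstates

/-! ### Value sets of finite families of sequences. -/

section FiniteEvaluation

variable {X : Type*} [Group X] [MetricSpace X] {d : ℕ → ℕ} [∀ k, NeZero (d k)]

/-- The finite set of values at `(k, j)` of the sequences in `S` and of the trivial sequence. -/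
def evalSet (S : Finset (∀ k, Fin (d k) → X)) (k : ℕ) (j : Fin (d k)) : NonemptyCompacts X :=
  ⟨⟨(fun s : ∀ k, Fin (d k) → X => s k j) '' insert 1 (S : Set (∀ k, Fin (d k) → X)),
    ((S.finite_toSet.insert 1).image _).isCompact⟩, ⟨_, 1, Set.mem_insert _ _, rfl⟩⟩

theorem one_mem_evalSet (S : Finset (∀ k, Fin (d k) → X)) (k : ℕ) (j : Fin (d k)) :
    (1 : X) ∈ evalSet S k j := ⟨1, Set.mem_insert _ _, rfl⟩

theorem mem_evalSet {S : Finset (∀ k, Fin (d k) → X)} {s : ∀ k, Fin (d k) → X} (hs : s ∈ S)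
    (k : ℕ) (j : Fin (d k)) : s k j ∈ evalSet S k j := ⟨s, Set.mem_insert_of_mem _ hs, rfl⟩

theorem evalSet_mono {S T : Finset (∀ k, Fin (d k) → X)} (h : S ⊆ T) (k : ℕ) (j : Fin (d k)) :
    (evalSet S k j : Set X) ⊆ evalSet T k j :=
  Set.image_mono (Set.insert_subset_insert (Finset.coe_subset.2 h))

variable [CompactSpace X] [MeasurableSpace X] [BorelSpace X]

/-- In a set of sequences, some finite subset is asymptotically as dense as every larger one. -/
theorem exists_finset_asymptotically_dense (ν : Measure X) [IsProbabilityMeasure ν]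
    [ν.IsOpenPosMeasure] (ω : Ultrafilter ℕ) (M : Set (∀ k, Fin (d k) → X)) {ε : ℝ}
    (hε : 0 < ε) :
    ∃ S : Finset (∀ k, Fin (d k) → X), (S : Set _) ⊆ M ∧
      ∀ T : Finset (∀ k, Fin (d k) → X), (T : Set _) ⊆ M → S ⊆ T →
        ∀ᶠ k in ω, avg (fun j => dist (evalSet S k j) (evalSet T k j)) < ε := by
  obtain ⟨D, hD0, hD⟩ := exists_dist_le X
  have hlim : ∀ S : Finset (∀ k, Fin (d k) → X), ∃ c ∈ Set.Icc 0 D,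
      Tendsto (fun k => avg fun j => meanDist ν (evalSet S k j)) ω (𝓝 c) := fun S =>
    ω.exists_tendsto_of_mem_Icc fun k => ⟨avg_nonneg fun j => meanDist_nonneg ν _,
      (avg_mono fun j => meanDist_le_of_dist_le ν hD _).trans (avg_const D).le⟩
  choose c hc hlim using hlim
  obtain ⟨C, hC, hdist⟩ := exists_dist_le_add_mul_meanDist_sub ν (half_pos hε)
  have hbdd : BddBelow (c '' {S | (S : Set _) ⊆ M}) := ⟨0, by rintro _ ⟨S, -, rfl⟩; exact (hc S).1⟩
  have hne : (c '' {S | (S : Set _) ⊆ M}).Nonempty := ⟨_, ∅, by simp, rfl⟩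
  have hδ : 0 < ε / (2 * (C + 1)) := by positivity
  -- `S` nearly minimizes the limiting average mean distance `c`. Enlarging it can lower `c` only
  -- slightly, so by `hdist` the value sets barely move.
  obtain ⟨_, ⟨S, hS, rfl⟩, hcS⟩ := Real.lt_sInf_add_pos hne hδ
  refine ⟨S, hS, fun T hT hST => ?_⟩
  have hcT : sInf (c '' {S | (S : Set _) ⊆ M}) ≤ c T := csInf_le hbdd ⟨T, hT, rfl⟩
  have hlt : c S - c T < ε / (2 * (C + 1)) := by linarith
  filter_upwards [((hlim S).sub (hlim T)).eventually (gt_mem_nhds hlt)] with k hk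
  calc avg (fun j => dist (evalSet S k j) (evalSet T k j))
      ≤ avg (fun j => ε / 2 + C * (meanDist ν (evalSet S k j) - meanDist ν (evalSet T k j))) :=
        avg_mono fun j => hdist _ _ (evalSet_mono hST k j)
    _ = ε / 2 + C * (avg (fun j => meanDist ν (evalSet S k j)) -
          avg fun j => meanDist ν (evalSet T k j)) := by
        rw [avg_add, avg_const, avg_const_mul, avg_sub]
    _ ≤ ε / 2 + C * (ε / (2 * (C + 1))) := by gcongr
    _ < ε := half_add_mul_lt hε hC

variable [IsTopologicalGroup X]

-- The almost densest family S of a group M is compared with the family of quotients from S ∪ {1},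
-- still inside M: its value sets contain the quotients of those of S, yet remain close to them.
open ClosedSubgroup in
theorem exists_finset_close_to_subgroup (ν : Measure X) [IsProbabilityMeasure ν]
    [ν.IsOpenPosMeasure] (ω : Ultrafilter ℕ) (M : Subgroup (∀ k, Fin (d k) → X)) {ε : ℝ}
    (hε : 0 < ε) :
    ∃ S : Finset (∀ k, Fin (d k) → X), (S : Set _) ⊆ (M : Set (∀ k, Fin (d k) → X)) ∧
      (∀ T : Finset (∀ k, Fin (d k) → X), (T : Set _) ⊆ (M : Set (∀ k, Fin (d k) → X)) → S ⊆ T →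
        ∀ᶠ k in ω, avg (fun j => dist (evalSet S k j) (evalSet T k j)) < ε) ∧
      ∀ᶠ k in ω, avg (fun j =>
        dist (evalSet S k j) (toNonemptyCompacts (nearest (evalSet S k j)))) < ε := by
  classical
  obtain ⟨C, hC, hnear⟩ := exists_dist_nearest_le_add_mul (X := X) (half_pos hε)
  obtain ⟨S, hSM, hS⟩ := exists_finset_asymptotically_dense ν ω
    (M : Set (∀ k, Fin (d k) → X)) (ε := min ε (ε / (2 * (C + 1)))) (by positivity)
  refine ⟨S, hSM, fun T hT hST => (hS T hT hST).mono fun k hk => hk.trans_le (min_le_left _ _), ?_⟩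
  let T : Finset (∀ k, Fin (d k) → X) :=
    ((insert 1 S) ×ˢ (insert 1 S)).image fun p : (∀ k, Fin (d k) → X) × _ => p.1 / p.2
  have hT : (T : Set _) ⊆ (M : Set (∀ k, Fin (d k) → X)) := by
    have h1 : ∀ s ∈ insert 1 S, s ∈ M := fun s hs => by
      rcases Finset.mem_insert.1 hs with rfl | hs
      · exact one_mem M
      · exact hSM hs
    intro t ht
    obtain ⟨p, hp, rfl⟩ := Finset.mem_image.1 (Finset.mem_coe.1 ht)
    exact div_mem (h1 _ (Finset.mem_product.1 hp).1) (h1 _ (Finset.mem_product.1 hp).2)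
  have hST : S ⊆ T := fun s hs => Finset.mem_image.2 ⟨(s, 1), by simp [hs], div_one s⟩
  have hq : ∀ k j, (quotients (evalSet S k j) : Set X) ⊆ evalSet T k j := by
    intro k j
    rw [coe_quotients]
    rintro _ ⟨⟨_, _⟩, ⟨⟨s, hs, rfl⟩, ⟨t, ht, rfl⟩⟩, rfl⟩
    exact mem_evalSet (s := s / t) (Finset.mem_image.2 ⟨(s, t), by
      simp only [Set.mem_insert_iff, Finset.mem_coe] at hs ht
      simp [hs, ht], rfl⟩) k j
  filter_upwards [hS T hT hST] with k hk
  have hk' := hk.trans_le (min_le_right _ _)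
  calc avg (fun j => dist (evalSet S k j) (toNonemptyCompacts (nearest (evalSet S k j))))
      ≤ avg (fun j => ε / 2 + C * dist (evalSet S k j) (evalSet T k j)) :=
        avg_mono fun j => hnear _ _ (one_mem_evalSet S k j) (hq k j)
    _ = ε / 2 + C * avg (fun j => dist (evalSet S k j) (evalSet T k j)) := by
        rw [avg_add, avg_const, avg_const_mul]
    _ ≤ ε / 2 + C * (ε / (2 * (C + 1))) := by gcongr
    _ < ε := half_add_mul_lt hε hC

end FiniteEvaluation

/-! ### The asymptotic subgroup of values and its invariance. -/

open ClosedSubgroup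

theorem tendsto_avg_zero_of_forall_lt {d : ℕ → ℕ} [∀ k, NeZero (d k)] {l : Filter ℕ}
    {a : ∀ k, Fin (d k) → ℝ} (h0 : ∀ k j, 0 ≤ a k j)
    (h : ∀ ε : ℝ, 0 < ε → ∀ᶠ k in l, avg (a k) < ε) : Tendsto (fun k => avg (a k)) l (𝓝 0) := by
  rw [Metric.tendsto_nhds]
  intro ε hε
  filter_upwards [h ε hε] with k hk
  rwa [Real.dist_eq, sub_zero, abs_of_nonneg (avg_nonneg (h0 k))]

section

variable {X : Type*} [Group X] [MetricSpace X] [CompactSpace X] [IsTopologicalGroup X]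
  {d : ℕ → ℕ} [∀ k, NeZero (d k)]

/-- `Y` is asymptotically the closed subgroup of values of the sequences in `M`. -/
def IsAsymptoticValueSubgroup (l : Filter ℕ) (M : Set (∀ k, Fin (d k) → X))
    (Y : ∀ k, Fin (d k) → ClosedSubgroup X) : Prop :=
  ∀ ε : ℝ, 0 < ε → ∃ S : Finset (∀ k, Fin (d k) → X), (S : Set _) ⊆ M ∧
    (∀ T : Finset (∀ k, Fin (d k) → X), (T : Set _) ⊆ M → S ⊆ T →
      ∀ᶠ k in l, avg (fun j => dist (evalSet S k j) (evalSet T k j)) < ε) ∧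
    ∀ᶠ k in l, avg (fun j => dist (evalSet S k j) (toNonemptyCompacts (Y k j))) < ε

/-- The almost densest families at tolerances 1/(n+1) are asymptotically close to one another. A
diagonal choice of n depending on k, followed by passage to a nearest subgroup, therefore serves
every tolerance. -/
theorem exists_isAsymptoticValueSubgroup [MeasurableSpace X] [BorelSpace X]
    (ν : Measure X) [IsProbabilityMeasure ν] [ν.IsOpenPosMeasure]
    {ω : Ultrafilter ℕ} (hω : (ω : Filter ℕ) ≤ atTop) (M : Subgroup (∀ k, Fin (d k) → X)) :
    ∃ Y : ∀ k, Fin (d k) → ClosedSubgroup X,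
      IsAsymptoticValueSubgroup ω (M : Set (∀ k, Fin (d k) → X)) Y := by
  classical
  have hε : ∀ n : ℕ, (0 : ℝ) < 1 / ((n : ℝ) + 1) := fun n => Nat.one_div_pos_of_nat
  choose S hSM hST hSY using fun n => exists_finset_close_to_subgroup ν ω M (hε n)
  have hpair : ∀ n m, ∀ᶠ k in ω, avg (fun j => dist (evalSet (S n) k j) (evalSet (S m) k j)) <
      1 / ((n : ℝ) + 1) + 1 / ((m : ℝ) + 1) := by
    intro n m
    -- Both families are compared with their union.
    have hU : ((S n ∪ S m : Finset _) : Set _) ⊆ (M : Set (∀ k, Fin (d k) → X)) := by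
      rw [Finset.coe_union]; exact Set.union_subset (hSM n) (hSM m)
    filter_upwards [hST n _ hU Finset.subset_union_left, hST m _ hU Finset.subset_union_right]
      with k h1 h2
    refine lt_of_le_of_lt ?_ (add_lt_add h1 h2)
    rw [← avg_add]
    exact avg_mono fun j => dist_triangle_right _ _ _
  obtain ⟨N, hN, hp⟩ := exists_tendsto_eventually_diagonal hω
    -- All `n ≤ m` are included, so that a fixed `S n` can be compared with `S (N k)` as soon as `n
    -- ≤ N k`.
    (p := fun m k => (∀ n ∈ Finset.range (m + 1),
        avg (fun j => dist (evalSet (S n) k j) (evalSet (S m) k j)) <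
          1 / ((n : ℝ) + 1) + 1 / ((m : ℝ) + 1)) ∧
      avg (fun j => dist (evalSet (S m) k j) (toNonemptyCompacts (nearest (evalSet (S m) k j)))) <
        1 / ((m : ℝ) + 1))
    fun m => ((Finset.eventually_all _).2 fun n _ => hpair n m).and (hSY m)
  refine ⟨fun k j => nearest (evalSet (S (N k)) k j), fun ε hε' => ?_⟩
  obtain ⟨n, hn⟩ := exists_nat_one_div_lt (by positivity : 0 < ε / 3)
  refine ⟨S n, hSM n, fun T hT hnT => (hST n T hT hnT).mono fun k hk => by linarith, ?_⟩
  filter_upwards [hp, hN.eventually_ge_atTop n] with k hk hNk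
  have h1 := hk.1 n (Finset.mem_range.2 (by omega))
  have h2 := hk.2
  have h3 : 1 / ((N k : ℝ) + 1) ≤ 1 / ((n : ℝ) + 1) := by gcongr
  calc avg (fun j => dist (evalSet (S n) k j)
        (toNonemptyCompacts (nearest (evalSet (S (N k)) k j))))
      ≤ avg (fun j => dist (evalSet (S n) k j) (evalSet (S (N k)) k j)) +
        avg (fun j => dist (evalSet (S (N k)) k j)
          (toNonemptyCompacts (nearest (evalSet (S (N k)) k j)))) := by
        rw [← avg_add]; exact avg_mono fun j => dist_triangle _ _ _
    _ < ε := by linarith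

/-- Adjoining φ to an almost densest family barely moves the value sets, so φ is already close to
the old ones and hence to Y. -/
theorem IsAsymptoticValueSubgroup.tendsto_avg_infDist {l : Filter ℕ}
    {M : Set (∀ k, Fin (d k) → X)} {Y : ∀ k, Fin (d k) → ClosedSubgroup X}
    (hY : IsAsymptoticValueSubgroup l M Y) {φ : ∀ k, Fin (d k) → X} (hφ : φ ∈ M) :
    Tendsto (fun k => avg fun j => Metric.infDist (φ k j) (Y k j : Set X)) l (𝓝 0) := by
  classical
  refine tendsto_avg_zero_of_forall_lt (fun _ _ => Metric.infDist_nonneg) fun ε hε => ?_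
  obtain ⟨S, hSM, hST, hSY⟩ := hY (ε / 2) (half_pos hε)
  have hT : ((insert φ S : Finset _) : Set _) ⊆ M := by
    rw [Finset.coe_insert]; exact Set.insert_subset hφ hSM
  filter_upwards [hST _ hT (Finset.subset_insert _ _), hSY] with k h1 h2
  calc avg (fun j => Metric.infDist (φ k j) (Y k j : Set X))
      ≤ avg (fun j => dist (evalSet S k j) (evalSet (insert φ S) k j)) +
        avg (fun j => dist (evalSet S k j) (toNonemptyCompacts (Y k j))) := by
        rw [← avg_add]
        refine avg_mono fun j => ?_
        have h3 := NonemptyCompacts.infDist_le_infDist_add_dist (φ k j)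
          (toNonemptyCompacts (Y k j)) (evalSet S k j)
        have h4 := NonemptyCompacts.infDist_le_dist_of_mem (B := evalSet S k j)
          (mem_evalSet (Finset.mem_insert_self φ S) k j)
        rw [dist_comm] at h3 h4
        exact h3.trans (add_le_add_left h4 _)
    _ < ε := by linarith

variable {G : Type*} [Group G] [MulDistribMulAction G X] [ContinuousConstSMul G X]
  (σ : ∀ k, G → Equiv.Perm (Fin (d k)))

theorem dist_map_smul_evalSet_le (S : Finset (∀ k, Fin (d k) → X)) (g : G) (k : ℕ)
    (j : Fin (d k)) :
    dist ((evalSet S k j).map (fun x => g • x) (continuous_const_smul g))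
        (evalSet S k (σ k g j)) ≤ ∑ s ∈ S, dist (g • s k j) (s k (σ k g j)) := by
  have h0 : 0 ≤ ∑ s ∈ S, dist (g • s k j) (s k (σ k g j)) :=
    Finset.sum_nonneg fun _ _ => dist_nonneg
  have hs : ∀ s ∈ insert 1 (S : Set (∀ k, Fin (d k) → X)),
      dist (g • s k j) (s k (σ k g j)) ≤ ∑ s ∈ S, dist (g • s k j) (s k (σ k g j)) := by
    rintro s (rfl | hs)
    · simpa using h0
    · exact Finset.single_le_sum (f := fun s : ∀ k, Fin (d k) → X =>
        dist (g • s k j) (s k (σ k g j))) (fun _ _ => dist_nonneg) hs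
  rw [Metric.NonemptyCompacts.dist_eq, NonemptyCompacts.coe_map]
  refine Metric.hausdorffDist_le_of_mem_dist h0 ?_ ?_
  · rintro _ ⟨_, ⟨s, hsS, rfl⟩, rfl⟩
    exact ⟨s k (σ k g j), ⟨s, hsS, rfl⟩, hs s hsS⟩
  · rintro _ ⟨s, hsS, rfl⟩
    exact ⟨g • s k j, ⟨_, ⟨s, hsS, rfl⟩, rfl⟩, (dist_comm _ _).trans_le (hs s hsS)⟩

theorem IsAsymptoticValueSubgroup.tendsto_avg_dist_translate {l : Filter ℕ}
    {Y : ∀ k, Fin (d k) → ClosedSubgroup X}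
    (hY : IsAsymptoticValueSubgroup l (microstateSubgroup (X := X) σ l : Set (∀ k, Fin (d k) → X)) Y)
    (g : G) :
    Tendsto (fun k => avg fun j => dist (translate g (Y k j)) (Y k (σ k g j))) l (𝓝 0) := by
  refine tendsto_avg_zero_of_forall_lt (fun _ _ => dist_nonneg) fun ε hε => ?_
  have hmap : Continuous (NonemptyCompacts.map (fun x : X => g • x) (continuous_const_smul g)) :=
    (continuous_const_smul g).nonemptyCompacts_map
  have hε4 : 0 < ε / 4 := by positivity
  obtain ⟨C, hC, hdist⟩ := hmap.exists_dist_le_add_mul hε4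
  -- The error between value set and subgroup enters twice: at `σ k g j` as it stands, and at `j`
  -- multiplied by `C` after translation by `g`.
  obtain ⟨S, hSM, -, hSY⟩ := hY (min (ε / 4) (ε / 4 / (C + 1))) (by positivity)
  have hdef : Tendsto (fun k => ∑ s ∈ S, equivarianceDefect σ g k (s k)) l (𝓝 (∑ s ∈ S, 0)) :=
    tendsto_finsetSum _ fun s hs => hSM hs g
  rw [Finset.sum_const_zero] at hdef
  filter_upwards [hSY, hdef.eventually (gt_mem_nhds hε4)] with k hk hk2
  have h1 := hk.trans_le (min_le_left _ _)
  have h2 := hk.trans_le (min_le_right _ _)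
  have h3 : C * avg (fun j => dist (evalSet S k j) (toNonemptyCompacts (Y k j))) ≤ ε / 4 := by
    calc _ ≤ C * (ε / 4 / (C + 1)) := by gcongr
      _ ≤ (C + 1) * (ε / 4 / (C + 1)) := by gcongr; linarith
      _ = ε / 4 := by field_simp
  calc avg (fun j => dist (translate g (Y k j)) (Y k (σ k g j)))
      ≤ avg (fun j => (ε / 4 + C * dist (evalSet S k j) (toNonemptyCompacts (Y k j))) +
          ((∑ s ∈ S, dist (g • s k j) (s k (σ k g j))) +
            -- Left as an application to `σ k g j` so that `avg_comp_perm` can remove the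
            -- permutation.
            (fun i => dist (evalSet S k i) (toNonemptyCompacts (Y k i))) (σ k g j))) := by
        refine avg_mono fun j => ?_
        have e1 := hdist (toNonemptyCompacts (Y k j)) (evalSet S k j)
        rw [dist_comm (toNonemptyCompacts (Y k j))] at e1
        have e2 := dist_map_smul_evalSet_le σ S g k j
        have e3 := dist_triangle4
          ((toNonemptyCompacts (Y k j)).map (fun x => g • x) (continuous_const_smul g))
          ((evalSet S k j).map (fun x => g • x) (continuous_const_smul g))
          (evalSet S k (σ k g j)) (toNonemptyCompacts (Y k (σ k g j)))
        have e4 : dist (translate g (Y k j)) (Y k (σ k g j)) = dist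
          ((toNonemptyCompacts (Y k j)).map (fun x => g • x) (continuous_const_smul g))
          (toNonemptyCompacts (Y k (σ k g j))) := rfl
        rw [e4]
        linarith
    _ = ε / 4 + C * avg (fun j => dist (evalSet S k j) (toNonemptyCompacts (Y k j))) +
          (∑ s ∈ S, equivarianceDefect σ g k (s k) +
            avg fun j => dist (evalSet S k j) (toNonemptyCompacts (Y k j))) := by
        rw [avg_add, avg_add, avg_add, avg_const, avg_const_mul, avg_finset_sum,
          avg_comp_perm (σ k g) fun i => dist (evalSet S k i) (toNonemptyCompacts (Y k i))]
        rfl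
    _ < ε := by linarith

/-- Translating Y by g is asymptotically the same as permuting its indices by σ_k(g), which leaves
empirical averages unchanged. -/
theorem IsAsymptoticValueSubgroup.isInvariantRandomSubgroup {l : Filter ℕ} [l.NeBot]
    {Y : ∀ k, Fin (d k) → ClosedSubgroup X}
    (hY : IsAsymptoticValueSubgroup l (microstateSubgroup (X := X) σ l : Set (∀ k, Fin (d k) → X)) Y)
    {η : ProbabilityMeasure (ClosedSubgroup X)}
    (hη : Tendsto (fun k => empirical (Y k)) l (𝓝 η)) : IsInvariantRandomSubgroup G η := by
  intro g
  have hg := continuous_translate (X := X) g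
  have hlim : ∀ f : ClosedSubgroup X → ℝ, Continuous f →
      Tendsto (fun k => avg fun j => f (Y k j)) l (𝓝 (∫ K, f K ∂(η : Measure _))) := by
    intro f hf
    have := ProbabilityMeasure.tendsto_iff_forall_integral_tendsto.1 hη
      (BoundedContinuousFunction.mkOfCompact ⟨f, hf⟩)
    refine this.congr fun k => ?_
    exact integral_empirical (Y k) hf.stronglyMeasurable
  have hfin : IsProbabilityMeasure ((η : Measure (ClosedSubgroup X)).map (translate g)) :=
    Measure.isProbabilityMeasure_map hg.measurable.aemeasurable
  refine Subtype.ext ?_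
  change (η : Measure (ClosedSubgroup X)).map (translate g) = η
  refine ext_of_forall_integral_eq_of_IsFiniteMeasure fun f => ?_
  rw [integral_map hg.measurable.aemeasurable
    f.continuous.aestronglyMeasurable]
  have h1 := hlim _ (f.continuous.comp hg)
  have h2 := hlim _ f.continuous
  have h3 : Tendsto (fun k => avg fun j => dist (f (translate g (Y k j))) (f (Y k (σ k g j)))) l
      (𝓝 0) := by
    refine tendsto_avg_zero_of_le_add_mul (fun _ _ => dist_nonneg) (fun ε hε => ?_)
      (hY.tendsto_avg_dist_translate σ g)
    obtain ⟨C, hC, h⟩ := f.continuous.exists_dist_le_add_mul hε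
    exact ⟨C, hC, fun k j => h _ _⟩
  have h4 : Tendsto (fun k => avg (fun j => f (translate g (Y k j))) - avg fun j => f (Y k j)) l
      (𝓝 0) := by
    refine squeeze_zero_norm (fun k => ?_) h3
    rw [← avg_comp_perm (σ k g) fun j => f (Y k j), ← avg_sub]
    exact abs_avg_le _
  exact sub_eq_zero.1 (tendsto_nhds_unique (h1.sub h2) h4)

/-- If the limit random subgroup is the whole group, finitely many microstates are
asymptotically dense. -/
theorem IsAsymptoticValueSubgroup.exists_dense [MeasurableSpace X] [BorelSpace X]
    (ν : Measure X) [IsProbabilityMeasure ν] [ν.IsOpenPosMeasure] {l : Filter ℕ}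
    {M : Set (∀ k, Fin (d k) → X)} {Y : ∀ k, Fin (d k) → ClosedSubgroup X}
    (hY : IsAsymptoticValueSubgroup l M Y)
    (hη : Tendsto (fun k => empirical (Y k)) l (𝓝 (diracWhole X))) {ε : ℝ} (hε : 0 < ε) :
    ∃ S : Finset (∀ k, Fin (d k) → X), (S : Set _) ⊆ M ∧
      ∀ᶠ k in l, avg (fun j => dist (evalSet S k j) (toNonemptyCompacts (whole X))) < ε := by
  have hf : Continuous fun K : ClosedSubgroup X => meanDist ν (toNonemptyCompacts K) :=
    (continuous_meanDist ν).comp continuous_toNonemptyCompacts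
  have hw : meanDist ν (toNonemptyCompacts (whole X)) = 0 := by
    have : ∀ x : X, Metric.infDist x (toNonemptyCompacts (whole X) : Set X) = 0 :=
      fun x => Metric.infDist_zero_of_mem trivial
    simp [meanDist, this]
  have hlim : Tendsto (fun k => avg fun j => meanDist ν (toNonemptyCompacts (Y k j))) l (𝓝 0) := by
    have := ProbabilityMeasure.tendsto_iff_forall_integral_tendsto.1 hη
      (BoundedContinuousFunction.mkOfCompact ⟨_, hf⟩)
    have h0 : ∫ K, meanDist ν (toNonemptyCompacts K) ∂(diracWhole X : Measure _) = 0 :=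
      (integral_dirac _ _).trans hw
    rw [← h0]
    refine this.congr fun k => ?_
    exact integral_empirical (Y k) hf.stronglyMeasurable
  obtain ⟨C, hC, hdist⟩ := exists_dist_le_add_mul_meanDist_sub ν (half_pos hε)
  have hδ : 0 < ε / (2 * (C + 1)) := by positivity
  -- Half of the allowance covers replacing `Y` by the value sets, the other half the mean distance
  -- to `Y`, which tends to 0.
  obtain ⟨S, hSM, -, hSY⟩ := hY _ (half_pos hδ)
  refine ⟨S, hSM, ?_⟩
  filter_upwards [hSY, hlim.eventually (gt_mem_nhds (half_pos hδ))] with k h1 h2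
  calc avg (fun j => dist (evalSet S k j) (toNonemptyCompacts (whole X)))
      ≤ avg (fun j => ε / 2 + C * (meanDist ν (toNonemptyCompacts (Y k j)) +
          dist (evalSet S k j) (toNonemptyCompacts (Y k j)))) := by
        refine avg_mono fun j => (hdist _ _ (Set.subset_univ _)).trans ?_
        rw [hw, sub_zero]
        gcongr
        exact meanDist_le_add_dist ν _ _
    _ = ε / 2 + C * (avg (fun j => meanDist ν (toNonemptyCompacts (Y k j))) +
          avg fun j => dist (evalSet S k j) (toNonemptyCompacts (Y k j))) := by
        rw [avg_add, avg_const, avg_const_mul, avg_add]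
    _ ≤ ε / 2 + C * (ε / (2 * (C + 1))) := by gcongr; linarith
    _ < ε := half_add_mul_lt hε hC

end

/-! ### Random words and Haar measure. -/

section RandomWords

variable {X : Type*} [Group X]

/-- The averaging operator of the uniform distribution on the entries of `t`. -/
noncomputable def leftAverage {r : ℕ} (t : Fin r → X) (f : X → ℝ) (x : X) : ℝ :=
  avg fun i => f (t i * x)

/-- Iterating the averaging operator N times amounts to averaging over all words of length N. The
words are formed at the level of sequences, so one finite family in M serves every (k, j). -/
theorem exists_words_iterate_leftAverage {d : ℕ → ℕ} {r : ℕ} [NeZero r]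
    (M : Subgroup (∀ k, Fin (d k) → X)) {a : Fin r → ∀ k, Fin (d k) → X} (ha : ∀ i, a i ∈ M)
    (N : ℕ) :
    ∃ n, ∃ _ : NeZero n, ∃ w : Fin n → ∀ k, Fin (d k) → X, (∀ i, w i ∈ M) ∧
      ∀ k j (f : X → ℝ) x,
        avg (fun i => f (w i k j * x)) = (leftAverage fun i => a i k j)^[N] f x := by
  induction N with
  | zero => exact ⟨1, inferInstance, fun _ => 1, fun _ => one_mem M, fun k j f x => by simp [avg]⟩
  | succ N ih =>
    obtain ⟨n, hn, w, hw, h⟩ := ih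
    -- The new letter goes on the right of the word, next to `x`, matching the outermost averaging
    -- in the iterate.
    refine ⟨r * n, inferInstance, fun p => w (finProdFinEquiv.symm p).2 *
      a (finProdFinEquiv.symm p).1, fun p => mul_mem (hw _) (ha _), fun k j f x => ?_⟩
    rw [Function.iterate_succ_apply']
    simp only [leftAverage, ← h]
    simp only [avg]
    rw [Equiv.sum_comp finProdFinEquiv.symm
      (fun p : Fin r × Fin n => f ((w p.2 * a p.1) k j * x)), Fintype.sum_prod_type,
      ← Finset.mul_sum, ← mul_assoc]
    congr 1
    · push_cast
      rw [one_div_mul_one_div]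
    · simp only [Pi.mul_apply, mul_assoc]

/-- One averaging contracts oscillation: among the r differences with the minimal g(t_j y), one is
at most ε and the others at most c + ε. -/
theorem leftAverage_sub_le {r : ℕ} [NeZero r] (t : Fin r → X) {g : X → ℝ} {c ε : ℝ}
    (hg : ∀ x y, g x - g y ≤ c + ε) (ht : ∀ x z, ∃ i, g (t i * x) - g z ≤ ε) (x y : X) :
    leftAverage t g x - leftAverage t g y ≤ (1 - 1 / (r : ℝ)) * c + ε := by
  obtain ⟨j₀, -, hj₀⟩ := Finset.exists_min_image Finset.univ (fun j => g (t j * y))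
    ⟨0, Finset.mem_univ _⟩
  obtain ⟨i₀, hi₀⟩ := ht x (t j₀ * y)
  have hy : g (t j₀ * y) ≤ leftAverage t g y := by
    rw [← avg_const (n := r) (g (t j₀ * y))]
    exact avg_mono fun j => hj₀ j (Finset.mem_univ _)
  have hr : (r : ℝ) ≠ 0 := Nat.cast_ne_zero.2 (NeZero.ne r)
  have hx : leftAverage t g x - g (t j₀ * y) ≤ (1 - 1 / (r : ℝ)) * c + ε := by
    calc leftAverage t g x - g (t j₀ * y) = avg fun i => g (t i * x) - g (t j₀ * y) := by
          rw [avg_sub, avg_const]; rfl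
      _ ≤ avg fun i => (c + ε) - if i = i₀ then c else 0 := by
          refine avg_mono fun i => ?_
          split_ifs with h
          · subst h; linarith
          · simpa using hg _ _
      _ = (1 - 1 / (r : ℝ)) * c + ε := by
          rw [avg_sub, avg_const]
          simp only [avg, Finset.sum_ite_eq', Finset.mem_univ, if_true]
          ring
  linarith

/-- The free left factor `b` makes the modulus of continuity stable: each averaging step is absorbed
into it. -/
theorem iterate_leftAverage_dist_le [MetricSpace X] {r : ℕ} [NeZero r] (t : Fin r → X)
    {f : X → ℝ} {δ ε : ℝ}
    (hf : ∀ b a a' x : X, dist a a' < δ → |f (b * a * x) - f (b * a' * x)| ≤ ε) (N : ℕ) :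
    ∀ b a a' x : X, dist a a' < δ →
      |(leftAverage t)^[N] f (b * a * x) - (leftAverage t)^[N] f (b * a' * x)| ≤ ε := by
  induction N with
  | zero => exact hf
  | succ N ih =>
    intro b a a' x h
    rw [Function.iterate_succ_apply']
    simp only [leftAverage, ← avg_sub]
    refine (abs_avg_le _).trans ((avg_mono fun i => ?_).trans (avg_const (n := r) ε).le)
    simpa only [mul_assoc] using ih (t i * b) a a' x h

theorem iterate_leftAverage_sub_le [MetricSpace X] {r : ℕ} [NeZero r] {t : Fin r → X}
    {f : X → ℝ} {δ ε D : ℝ} (hD : ∀ x y, f x - f y ≤ D) (hε : 0 ≤ ε)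
    (hf : ∀ b a a' x : X, dist a a' < δ → |f (b * a * x) - f (b * a' * x)| ≤ ε)
    (ht : ∀ y, ∃ i, dist (t i) y < δ) (N : ℕ) :
    ∀ x y, (leftAverage t)^[N] f x - (leftAverage t)^[N] f y ≤
      (1 - 1 / (r : ℝ)) ^ N * D + ε := by
  induction N with
  | zero => intro x y; simpa using (hD x y).trans (le_add_of_nonneg_right hε)
  | succ N ih =>
    rw [Function.iterate_succ', pow_succ', mul_assoc]
    refine leftAverage_sub_le t ih fun x z => ?_
    -- A letter near `z * x⁻¹` carries `x` near `z`.
    obtain ⟨i, hi⟩ := ht (z * x⁻¹)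
    refine ⟨i, ?_⟩
    have := iterate_leftAverage_dist_le t hf N 1 _ _ x hi
    simp only [one_mul, inv_mul_cancel_right] at this
    exact (le_abs_self _).trans this

variable [MetricSpace X] [CompactSpace X] [IsTopologicalGroup X] [MeasurableSpace X] [BorelSpace X]

theorem continuous_iterate_leftAverage {r : ℕ} (t : Fin r → X) {f : X → ℝ} (hf : Continuous f)
    (N : ℕ) : Continuous ((leftAverage t)^[N] f) := by
  induction N with
  | zero => exact hf
  | succ N ih =>
    rw [Function.iterate_succ_apply']
    unfold leftAverage avg
    fun_prop

theorem integral_iterate_leftAverage {r : ℕ} [NeZero r] (t : Fin r → X) {f : X → ℝ}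
    (hf : Continuous f) (N : ℕ) :
    ∫ x, (leftAverage t)^[N] f x ∂(haarProb X : Measure X) =
      ∫ x, f x ∂(haarProb X : Measure X) := by
  have hinv : (haarProb X : Measure X).IsMulLeftInvariant :=
    inferInstanceAs (Measure.haarMeasure (⊤ : PositiveCompacts X)).IsMulLeftInvariant
  induction N with
  | zero => rfl
  | succ N ih =>
    have hc := continuous_iterate_leftAverage t hf N
    rw [Function.iterate_succ_apply', ← ih]
    simp only [leftAverage, avg]
    rw [integral_const_mul,
      integral_finsetSum (f := fun i x => (leftAverage t)^[N] f (t i * x)) _ fun i _ =>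
      integrable_of_continuous _ (hc.comp (continuous_const_mul (t i)))]
    simp only [integral_mul_left_eq_self]
    have hr : (r : ℝ) ≠ 0 := Nat.cast_ne_zero.2 (NeZero.ne r)
    simp only [Finset.sum_const, Finset.card_univ, Fintype.card_fin, nsmul_eq_mul]
    field_simp

/-- Long random words in a sufficiently dense finite set are nearly Haar distributed, with a
length depending only on the size of the set. -/
theorem eventually_iterate_leftAverage_near_integral {f : X → ℝ} (hf : Continuous f) {ε : ℝ}
    (hε : 0 < ε) :
    ∀ᶠ δ in 𝓝[>] (0 : ℝ), ∀ r : ℕ, r ≠ 0 → ∀ᶠ N in atTop, ∀ t : Fin r → X,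
      (∀ y, ∃ i, dist (t i) y < δ) →
        |(leftAverage t)^[N] f 1 - ∫ x, f x ∂(haarProb X : Measure X)| < ε := by
  have huc : UniformContinuous fun p : X × X × X => f (p.1 * p.2.1 * p.2.2) :=
    CompactSpace.uniformContinuous_of_continuous (by fun_prop)
  obtain ⟨δ₀, hδ₀, hmod⟩ := Metric.uniformContinuous_iff.1 huc (ε / 2) (half_pos hε)
  obtain ⟨C, hC⟩ := (isCompact_range hf).isBounded.exists_norm_le
  have hD : ∀ x y, f x - f y ≤ 2 * C := fun x y => by
    have h1 := hC _ ⟨x, rfl⟩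
    have h2 := hC _ ⟨y, rfl⟩
    rw [Real.norm_eq_abs, abs_le] at h1 h2
    linarith
  filter_upwards [Ioo_mem_nhdsGT hδ₀] with δ hδ r hr
  have hr' : NeZero r := ⟨hr⟩
  have hpow : Tendsto (fun N : ℕ => (1 - 1 / (r : ℝ)) ^ N * (2 * C) + ε / 2) atTop
      (𝓝 (0 * (2 * C) + ε / 2)) := by
    refine ((tendsto_pow_atTop_nhds_zero_of_lt_one ?_ ?_).mul_const _).add_const _
    · rw [sub_nonneg, div_le_one (by positivity)]
      exact_mod_cast Nat.one_le_iff_ne_zero.2 hr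
    · have : 0 < 1 / (r : ℝ) := by positivity
      linarith
  filter_upwards [hpow.eventually (gt_mem_nhds (by linarith : 0 * (2 * C) + ε / 2 < ε))]
    with N hN t ht
  have hosc := iterate_leftAverage_sub_le hD (half_pos hε).le (fun b a a' x h => by
    have := hmod (a := (b, a, x)) (b := (b, a', x)) (by
      simp only [Prod.dist_eq, dist_self]
      simpa [hδ₀] using h.trans hδ.2)
    exact (Real.dist_eq _ _ ▸ this).le) ht N
  have hint := integrable_of_continuous (haarProb X : Measure X)
    (continuous_iterate_leftAverage t hf N)
  -- Left invariance gives the iterate the same Haar mean as `f`, so its value at 1 differs from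
  -- that mean by at most its oscillation.
  have heq : (leftAverage t)^[N] f 1 - ∫ x, f x ∂(haarProb X : Measure X) =
      ∫ x, ((leftAverage t)^[N] f 1 - (leftAverage t)^[N] f x) ∂(haarProb X : Measure X) := by
    rw [integral_sub (integrable_const _) hint, integral_iterate_leftAverage t hf]
    simp
  rw [heq]
  refine lt_of_le_of_lt ?_ hN
  have := norm_integral_le_of_norm_le_const (μ := (haarProb X : Measure X))
    (f := fun x => (leftAverage t)^[N] f 1 - (leftAverage t)^[N] f x)
    (Eventually.of_forall fun x => abs_le.2 ⟨by linarith [hosc x 1], hosc 1 x⟩)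
  simpa using this

/-- Weak-star neighborhoods are determined by finitely many test functions. -/
theorem exists_finite_test_functions {ν : ProbabilityMeasure X} {O : Set (ProbabilityMeasure X)}
    (hO : O ∈ 𝓝 ν) :
    ∃ I : Set (BoundedContinuousFunction X ℝ), I.Finite ∧
      ∃ ε : BoundedContinuousFunction X ℝ → ℝ, (∀ f, 0 < ε f) ∧
      ∀ μ : ProbabilityMeasure X,
        (∀ f ∈ I, |∫ x, f x ∂(μ : Measure X) - ∫ x, f x ∂(ν : Measure X)| < ε f) → μ ∈ O := by
  let e : ProbabilityMeasure X → BoundedContinuousFunction X ℝ → ℝ :=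
    fun μ f => ∫ x, f x ∂(μ : Measure X)
  -- Convergence of all integrals implies weak-star convergence, so neighborhoods of `ν` contain
  -- pullbacks of product neighborhoods under `e`.
  have ht : Tendsto id (comap e (𝓝 (e ν))) (𝓝 ν) :=
    ProbabilityMeasure.tendsto_iff_forall_integral_tendsto.2 fun f =>
      ((continuous_apply f).tendsto (e ν)).comp tendsto_comap
  obtain ⟨V, hV, hVO⟩ := Filter.mem_comap.1 (ht hO)
  rw [nhds_pi, Filter.mem_pi] at hV
  obtain ⟨I, hI, W, hW, hWV⟩ := hV
  choose ε hε hball using fun f => Metric.mem_nhds_iff.1 (hW f)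
  exact ⟨I, hI, ε, hε, fun μ hμ => hVO (hWV fun f hf => hball f (by
    rw [Metric.mem_ball, Real.dist_eq]; exact hμ f hf))⟩

/-- The order of quantifiers is essential: δ is fixed before the family is chosen, and N depends on
its size alone, so a single word length works at all coordinates. -/
theorem eventually_mem_of_integral_eq_leftAverage {O : Set (ProbabilityMeasure X)}
    (hO : O ∈ 𝓝 (haarProb X)) :
    ∃ δ > (0 : ℝ), ∀ r : ℕ, r ≠ 0 → ∃ N : ℕ, ∀ t : Fin r → X, (∀ y, ∃ i, dist (t i) y < δ) →
      ∀ μ : ProbabilityMeasure X, (∀ f : X → ℝ, Continuous f →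
        ∫ x, f x ∂(μ : Measure X) = (leftAverage t)^[N] f 1) → μ ∈ O := by
  obtain ⟨I, hI, ε, hε, h⟩ := exists_finite_test_functions hO
  have h1 := (eventually_all_finite hI).2 fun f _ =>
    eventually_iterate_leftAverage_near_integral f.continuous (hε f)
  obtain ⟨δ, hδ, hδ0⟩ := (h1.and self_mem_nhdsWithin).exists
  refine ⟨δ, hδ0, fun r hr => ?_⟩
  obtain ⟨N, hN⟩ := ((eventually_all_finite hI).2 fun f hf => hδ f hf r hr).exists
  refine ⟨N, fun t ht μ hμ => h μ fun f hf => ?_⟩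
  rw [hμ f f.continuous]
  exact hN f hf t ht

end RandomWords

instance haarProb_isOpenPosMeasure (X : Type*) [Group X] [TopologicalSpace X]
    [IsTopologicalGroup X] [CompactSpace X] [MeasurableSpace X] [BorelSpace X] :
    (haarProb X : Measure X).IsOpenPosMeasure :=
  inferInstanceAs (Measure.haarMeasure (⊤ : PositiveCompacts X)).IsOpenPosMeasure

/-! ### Near-Haar microstates and the construction of the random subgroup. -/

section

variable {G X : Type*} [Group G] [Group X] [MetricSpace X] [CompactSpace X]
  [MeasurableSpace X] [BorelSpace X] [MulDistribMulAction G X] [ContinuousConstSMul G X]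
  {d : ℕ → ℕ} [∀ k, NeZero (d k)] (σ : ∀ k, G → Equiv.Perm (Fin (d k)))

/-- The microstates with tolerance `1 / (n + 1)` at the group elements `e 0, …, e n`. -/
def approxMicrostates (e : ℕ → G) (n k : ℕ) : Set (Fin (d k) → X) :=
  {φ | ∀ i ∈ Finset.range (n + 1), equivarianceDefect σ (e i) k φ < 1 / ((n : ℝ) + 1)}

theorem measurableSet_approxMicrostates (e : ℕ → G) (n k : ℕ) :
    MeasurableSet (approxMicrostates (X := X) σ e n k) := by
  have : approxMicrostates (X := X) σ e n k = ⋂ i ∈ Finset.range (n + 1),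
      {φ | equivarianceDefect σ (e i) k φ < 1 / ((n : ℝ) + 1)} := by
    ext φ; simp [approxMicrostates]
  rw [this]
  exact Finset.measurableSet_biInter _ fun i _ =>
    (isOpen_lt (continuous_equivarianceDefect σ (e i) k) continuous_const).measurableSet

theorem tendsto_defect_of_mem_approxMicrostates {e : ℕ → G} (he : Function.Surjective e)
    {N : ℕ → ℕ} (hN : Tendsto N atTop atTop) {φ : ∀ k, Fin (d k) → X}
    (hφ : ∀ᶠ k in atTop, φ k ∈ approxMicrostates σ e (N k) k) (g : G) :
    Tendsto (fun k => equivarianceDefect σ g k (φ k)) atTop (𝓝 0) := by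
  obtain ⟨i, rfl⟩ := he g
  refine tendsto_of_tendsto_of_tendsto_of_le_of_le' tendsto_const_nhds
    (tendsto_one_div_add_atTop_nhds_zero_nat.comp hN)
    (Eventually.of_forall fun k => equivarianceDefect_nonneg σ _ k _) ?_
  filter_upwards [hφ, hN.eventually_ge_atTop i] with k hk hik
  exact (hk i (Finset.mem_range.2 (by omega))).le

/-- Some measure on `X ^ (d k)` is supported on microstates and has marginals near Haar measure,
with tolerance given by `n`. -/
def HasNearHaarMicrostates [IsTopologicalGroup X] (e : ℕ → G)
    (O : ℕ → Set (ProbabilityMeasure X)) (n k : ℕ) : Prop :=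
  ∃ μ : ProbabilityMeasure (Fin (d k) → X),
    1 - 1 / ((n : ℝ) + 1) ≤ μ (approxMicrostates σ e n k) ∧
    1 - 1 / ((n : ℝ) + 1) ≤ uniformProb (d k) {j | marginal μ j ∈ O n}

theorem ProbabilityMeasure.tendsto_coe_one_of_le {ι : Type*} {l : Filter ι} {Ω : ι → Type*}
    [∀ k, MeasurableSpace (Ω k)] (μ : ∀ k, ProbabilityMeasure (Ω k)) (A : ∀ k, Set (Ω k))
    {N : ι → ℕ} (hN : Tendsto N l atTop)
    (h : ∀ᶠ k in l, 1 - 1 / ((N k : ℝ) + 1) ≤ μ k (A k)) :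
    Tendsto (fun k => (μ k (A k) : ℝ)) l (𝓝 1) := by
  have h1 : Tendsto (fun k => 1 - 1 / ((N k : ℝ) + 1)) l (𝓝 (1 - 0)) :=
    tendsto_const_nhds.sub (tendsto_one_div_add_atTop_nhds_zero_nat.comp hN)
  rw [sub_zero] at h1
  exact tendsto_of_tendsto_of_tendsto_of_le_of_le' h1 tendsto_const_nhds h
    (Eventually.of_forall fun k => NNReal.coe_le_coe.2 (ProbabilityMeasure.apply_le_one _ _))

variable [IsTopologicalGroup X]

theorem exists_locallyWeakStarTendsto_haarProb {e : ℕ → G} (he : Function.Surjective e)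
    {O : ℕ → Set (ProbabilityMeasure X)} (hO : (𝓝 (haarProb X)).HasAntitoneBasis O)
    (h : ∀ n, ∀ᶠ k in atTop, HasNearHaarMicrostates σ e O n k) :
    ∃ μ : ∀ k, ProbabilityMeasure (Fin (d k) → X),
      AsympSupportedOnTopMicrostates σ μ ∧ LocallyWeakStarTendsto μ (haarProb X) := by
  obtain ⟨N, hN, hp⟩ := exists_tendsto_eventually_diagonal le_rfl h
  have hex : ∀ k, ∃ μ : ProbabilityMeasure (Fin (d k) → X), HasNearHaarMicrostates σ e O (N k) k →
      1 - 1 / ((N k : ℝ) + 1) ≤ μ (approxMicrostates σ e (N k) k) ∧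
      1 - 1 / ((N k : ℝ) + 1) ≤ uniformProb (d k) {j | marginal μ j ∈ O (N k)} := by
    intro k
    by_cases hk : HasNearHaarMicrostates σ e O (N k) k
    · exact hk.imp fun μ hμ _ => hμ
    · exact ⟨⟨Measure.dirac 1, inferInstance⟩, fun h => absurd h hk⟩
  choose μ hμ using hex
  refine ⟨μ, fun g U hU hdU ε hε => ?_, fun V hV => ?_⟩
  · obtain ⟨i, rfl⟩ := he g
    obtain ⟨δ, hδ, hδU⟩ := exists_dist_lt_of_mem_nhdsSet_diagonal
      (hU.mem_nhdsSet.2 hdU)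
    have hlim := (tendsto_one_div_add_atTop_nhds_zero_nat (𝕜 := ℝ)).comp hN
    refine ProbabilityMeasure.tendsto_coe_one_of_le μ _ hN ?_
    filter_upwards [hp, hN.eventually_ge_atTop i,
      hlim.eventually (gt_mem_nhds (mul_pos hε hδ))] with k hk hik hsmall
    refine (hμ k hk).1.trans (NNReal.coe_le_coe.2 ((μ k).apply_mono fun φ hφ => ?_))
    have h1 := hφ i (Finset.mem_range.2 (by omega))
    have h2 : equivarianceDefect σ (e i) k φ / δ < ε := by
      rw [div_lt_iff₀ hδ]; exact h1.trans hsmall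
    have h3 := one_sub_le_uniformProb (a := fun j => dist (e i • φ j) (φ (σ k (e i) j)))
      (fun _ => dist_nonneg) hδ
    have h4 := uniformProb_mono (s := {j | dist (e i • φ j) (φ (σ k (e i) j)) < δ})
      (t := {j | (φ (σ k (e i) j), e i • φ j) ∈ U})
      fun j hj => hδU _ _ (by rw [dist_comm]; exact hj)
    change 1 - ε < _
    unfold equivarianceDefect at h2
    linarith
  · obtain ⟨m, hm⟩ := hO.mem_iff.1 hV
    refine ProbabilityMeasure.tendsto_coe_one_of_le (fun k => uniformProb (d k)) _ hN ?_
    filter_upwards [hp, hN.eventually_ge_atTop m] with k hk hmk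
    exact (hμ k hk).2.trans (uniformProb_mono fun j hj => hm (hO.antitone hmk hj))

/-- The measure is uniform on long words in S. Words stay in the microstate group, and the marginal
at j is the law of a random word in the letters evaluated at j, nearly Haar wherever these are
δ-dense. -/
theorem eventually_hasNearHaarMicrostates (e : ℕ → G)
    {O : ℕ → Set (ProbabilityMeasure X)} (hO : ∀ n, O n ∈ 𝓝 (haarProb X)) {l : Filter ℕ}
    (h : ∀ ε : ℝ, 0 < ε → ∃ S : Finset (∀ k, Fin (d k) → X),
      (S : Set _) ⊆ (microstateSubgroup (X := X) σ l : Set (∀ k, Fin (d k) → X)) ∧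
      ∀ᶠ k in l, avg (fun j => dist (evalSet S k j) (toNonemptyCompacts (whole X))) < ε) (n : ℕ) :
    ∀ᶠ k in l, HasNearHaarMicrostates σ e O n k := by
  classical
  have hn : (0 : ℝ) < 1 / ((n : ℝ) + 1) := Nat.one_div_pos_of_nat
  obtain ⟨δ, hδ, hδO⟩ := eventually_mem_of_integral_eq_leftAverage (hO n)
  -- By Markov's inequality, an average below δ/(n+1) leaves a fraction of at most 1/(n+1) of the
  -- indices where δ-density may fail.
  obtain ⟨S, hSM, hS⟩ := h _ (mul_pos hn hδ)
  let a : Fin (insert 1 S).card → ∀ k, Fin (d k) → X := fun i => ((insert 1 S).equivFin.symm i).1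
  have hcard : (insert 1 S).card ≠ 0 := Finset.card_ne_zero_of_mem (Finset.mem_insert_self 1 S)
  have hr : NeZero (insert 1 S).card := ⟨hcard⟩
  have haM : ∀ i, a i ∈ microstateSubgroup (X := X) σ l := fun i => by
    rcases Finset.mem_insert.1 ((insert 1 S).equivFin.symm i).2 with h1 | h1
    · change ((insert 1 S).equivFin.symm i).1 ∈ _
      rw [h1]; exact one_mem _
    · exact hSM h1
  obtain ⟨N, hN⟩ := hδO _ hcard
  obtain ⟨m, hm, w, hw, hword⟩ := exists_words_iterate_leftAverage _ haM N
  have hdef : ∀ᶠ k in l, ∀ p, w p k ∈ approxMicrostates σ e n k :=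
    eventually_all.2 fun p => (Finset.eventually_all _).2 fun i _ =>
      (hw p (e i)).eventually (gt_mem_nhds hn)
  filter_upwards [hS, hdef] with k hk hdk
  refine ⟨empirical fun p => w p k, ?_, ?_⟩
  · have h1 : empirical (fun p => w p k) (approxMicrostates σ e n k) = 1 := by
      rw [empirical, ProbabilityMeasure.map_apply _ _ (measurableSet_approxMicrostates σ e n k)]
      have : (fun p => w p k) ⁻¹' approxMicrostates σ e n k = Set.univ :=
        Set.eq_univ_of_forall hdk
      rw [this, ProbabilityMeasure.coeFn_univ]
    rw [h1, NNReal.coe_one]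
    linarith
  · have h1 := one_sub_le_uniformProb
      (a := fun j => dist (evalSet S k j) (toNonemptyCompacts (whole X)))
      (fun _ => dist_nonneg) hδ
    have h2 := (div_lt_iff₀ hδ).2 hk
    refine le_trans (by linarith) (h1.trans (uniformProb_mono fun j hj => ?_))
    refine hN (fun i => a i k j) (fun y => ?_) _ fun f hf => ?_
    · have h3 := (NonemptyCompacts.infDist_le_dist_of_mem (B := evalSet S k j)
        (show y ∈ toNonemptyCompacts (whole X) from trivial)).trans_lt
          ((dist_comm _ _).trans_lt hj)
      obtain ⟨_, ⟨s, hs, rfl⟩, hys⟩ :=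
        (Metric.infDist_lt_iff (evalSet S k j).nonempty).1 h3
      have hs' : s ∈ insert 1 S := by simpa using hs
      refine ⟨(insert 1 S).equivFin ⟨s, hs'⟩, ?_⟩
      simp only [a, Equiv.symm_apply_apply]
      rwa [dist_comm]
    · have hmar : ∫ x, f x ∂(marginal (empirical fun p => w p k) j : Measure X) =
          ∫ φ, f (φ j) ∂(empirical (fun p => w p k) : Measure (Fin (d k) → X)) :=
        integral_map (measurable_pi_apply j).aemeasurable hf.aestronglyMeasurable
      rw [hmar, integral_empirical (f := fun φ : Fin (d k) → X => f (φ j)) _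
          (hf.comp (continuous_apply j)).stronglyMeasurable,
        ← hword k j f 1]
      simp only [mul_one]

theorem exists_random_subgroup_of_not_exists [Countable G]
    (h : ¬ ∃ μ : ∀ k, ProbabilityMeasure (Fin (d k) → X),
      AsympSupportedOnTopMicrostates σ μ ∧ LocallyWeakStarTendsto μ (haarProb X)) :
    ∃ η : ProbabilityMeasure (ClosedSubgroup X),
      IsInvariantRandomSubgroup G η ∧ η ≠ diracWhole X ∧
      ∃ Y : ∀ k, Fin (d k) → ClosedSubgroup X,
        ∀ φ : ∀ k, Fin (d k) → X, IsTopMicrostates σ φ →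
          ∃ κ : ℕ → ℕ, StrictMono κ ∧
            Tendsto (fun l => empirical (Y (κ l))) atTop (𝓝 η) ∧
            Tendsto (fun l => avg fun j =>
              Metric.infDist (φ (κ l) j) (Y (κ l) j : Set X)) atTop (𝓝 0) := by
  obtain ⟨e, he⟩ := exists_surjective_nat G
  obtain ⟨O, hO⟩ := (𝓝 (haarProb X)).exists_antitone_basis
  have hbad : ∃ n, ∃ᶠ k in atTop, ¬ HasNearHaarMicrostates σ e O n k := by
    by_contra hcon
    push Not at hcon
    exact h (exists_locallyWeakStarTendsto_haarProb σ he hO hcon)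
  obtain ⟨n, hn⟩ := hbad
  have hne : (atTop ⊓ 𝓟 {k | ¬ HasNearHaarMicrostates σ e O n k}).NeBot :=
    frequently_mem_iff_neBot.1 hn
  -- The ultrafilter lives on the indices where near-Haar microstates do not exist at tolerance `n`;
  -- this is what excludes `δ_X` below.
  let ω := Ultrafilter.of (atTop ⊓ 𝓟 {k | ¬ HasNearHaarMicrostates σ e O n k})
  have hω : (ω : Filter ℕ) ≤ atTop ⊓ 𝓟 {k | ¬ HasNearHaarMicrostates σ e O n k} :=
    Ultrafilter.of_le _
  have hωtop : (ω : Filter ℕ) ≤ atTop := hω.trans inf_le_left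
  obtain ⟨Y, hY⟩ := exists_isAsymptoticValueSubgroup (haarProb X : Measure X) hωtop
    (microstateSubgroup (X := X) σ ω)
  obtain ⟨η, -, hη⟩ := (isCompact_univ : IsCompact (Set.univ :
    Set (ProbabilityMeasure (ClosedSubgroup X)))).ultrafilter_le_nhds
      (ω.map fun k => empirical (Y k)) (by simp)
  have hη' : Tendsto (fun k => empirical (Y k)) ω (𝓝 η) := hη
  refine ⟨η, hY.isInvariantRandomSubgroup σ hη', ?_, Y, fun φ hφ => ?_⟩
  · rintro rfl
    have hgood := eventually_hasNearHaarMicrostates σ e (fun m => hO.mem m)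
      (fun ε hε => hY.exists_dense (haarProb X : Measure X) hη' hε) n
    obtain ⟨k, hk, hk'⟩ :=
      (hgood.and (hω (mem_inf_of_right (mem_principal_self _)))).exists
    exact hk' hk
  · have hφM : φ ∈ microstateSubgroup (X := X) σ ω :=
      fun g => (hφ.tendsto_defect σ g).mono_left hωtop
    -- Pairing the two limits yields one subsequence for both. It depends on `φ`, whereas `η` and
    -- `Y` do not.
    have hpair := hη'.prodMk_nhds (hY.tendsto_avg_infDist hφM)
    obtain ⟨κ, hκ, hlim⟩ := subseq_tendsto_of_neBot
      (f := 𝓝 (η, (0 : ℝ))) (u := fun k => (empirical (Y k),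
        avg fun j => Metric.infDist (φ k j) (Y k j : Set X)))
      (neBot_of_le (le_inf hpair (map_mono hωtop)))
    exact ⟨κ, hκ, (continuous_fst.tendsto _).comp hlim, (continuous_snd.tendsto _).comp hlim⟩

end

/-! ### The converse: near-Haar microstates force the point mass. -/

section

variable {G X : Type*} [Group G] [Group X] [MetricSpace X] [CompactSpace X]
  [MeasurableSpace X] [BorelSpace X] [MulDistribMulAction G X] [ContinuousConstSMul G X]
  {d : ℕ → ℕ} [∀ k, NeZero (d k)] (σ : ∀ k, G → Equiv.Perm (Fin (d k)))

theorem AsympSupportedOnTopMicrostates.tendsto_defect_lt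
    {μ : ∀ k, ProbabilityMeasure (Fin (d k) → X)} (h : AsympSupportedOnTopMicrostates σ μ) (g : G)
    {τ : ℝ} (hτ : 0 < τ) :
    Tendsto (fun k => (μ k {φ | equivarianceDefect σ g k φ < τ} : ℝ)) atTop (𝓝 1) := by
  obtain ⟨D, hDpos, hD⟩ := exists_dist_le X
  have hD0 : 0 ≤ D := hDpos.le
  have hε : 0 < τ / (2 * (D + 1)) := by positivity
  refine tendsto_of_tendsto_of_tendsto_of_le_of_le
    (h g {p | dist p.1 p.2 < τ / 2} (isOpen_lt (by fun_prop) continuous_const)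
      (fun p hp => by
        rw [Set.mem_diagonal_iff] at hp
        simpa [hp] using hτ) _ hε)
    tendsto_const_nhds (fun k => NNReal.coe_le_coe.2 ((μ k).apply_mono fun φ hφ => ?_))
    fun k => NNReal.coe_le_coe.2 (ProbabilityMeasure.apply_le_one _ _)
  have h1 := avg_le_of_uniformProb (a := fun j => dist (g • φ j) (φ (σ k g j))) (C := D)
    (s := {j | (φ (σ k g j), g • φ j) ∈ {p : X × X | dist p.1 p.2 < τ / 2}}) (ε := τ / 2)
    (fun j hj => by rw [dist_comm]; exact le_of_lt hj)
    (fun j => (hD _ _).trans (by linarith))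
  change 1 - τ / (2 * (D + 1)) < _ at hφ
  have h2 : D * (1 - (uniformProb (d k)
      {j | (φ (σ k g j), g • φ j) ∈ {p : X × X | dist p.1 p.2 < τ / 2}} : ℝ)) ≤
      D * (τ / (2 * (D + 1))) := mul_le_mul_of_nonneg_left (by linarith) hD0
  have h3 := half_add_mul_lt hτ hD0
  change avg (fun j => dist (g • φ j) (φ (σ k g j))) < τ
  linarith

theorem ProbabilityMeasure.one_sub_apply_biInter_le {Ω ι : Type*} [MeasurableSpace Ω]
    (μ : ProbabilityMeasure Ω) (s : Finset ι) {A : ι → Set Ω} (hA : ∀ i ∈ s, MeasurableSet (A i)) :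
    1 - (μ (⋂ i ∈ s, A i) : ℝ) ≤ ∑ i ∈ s, (1 - (μ (A i) : ℝ)) := by
  have h1 : 1 - (μ (⋂ i ∈ s, A i) : ℝ) = (μ : Measure Ω).real (⋃ i ∈ s, (A i)ᶜ) := by
    rw [← Set.compl_iInter₂, probReal_compl_eq_one_sub (Finset.measurableSet_biInter s hA)]
    rfl
  rw [h1]
  refine (measureReal_biUnion_finset_le s _).trans (Finset.sum_le_sum fun i hi => ?_)
  rw [probReal_compl_eq_one_sub (hA i hi)]
  exact le_rfl

theorem AsympSupportedOnTopMicrostates.tendsto_approxMicrostates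
    {μ : ∀ k, ProbabilityMeasure (Fin (d k) → X)} (h : AsympSupportedOnTopMicrostates σ μ)
    (e : ℕ → G) (n : ℕ) :
    Tendsto (fun k => (μ k (approxMicrostates σ e n k) : ℝ)) atTop (𝓝 1) := by
  have hn : (0 : ℝ) < 1 / ((n : ℝ) + 1) := Nat.one_div_pos_of_nat
  have h1 : Tendsto (fun k => 1 - ∑ i ∈ Finset.range (n + 1),
      (1 - (μ k {φ | equivarianceDefect σ (e i) k φ < 1 / ((n : ℝ) + 1)} : ℝ))) atTop
      (𝓝 (1 - ∑ i ∈ Finset.range (n + 1), (1 - 1))) :=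
    tendsto_const_nhds.sub (tendsto_finsetSum _ fun i _ =>
      tendsto_const_nhds.sub (h.tendsto_defect_lt σ (e i) hn))
  simp only [sub_self, Finset.sum_const_zero, sub_zero] at h1
  refine tendsto_of_tendsto_of_tendsto_of_le_of_le h1 tendsto_const_nhds (fun k => ?_)
    fun k => NNReal.coe_le_coe.2 (ProbabilityMeasure.apply_le_one _ _)
  have h2 : approxMicrostates (X := X) σ e n k = ⋂ i ∈ Finset.range (n + 1),
      {φ | equivarianceDefect σ (e i) k φ < 1 / ((n : ℝ) + 1)} := by
    ext φ; simp [approxMicrostates]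
  have h3 := ProbabilityMeasure.one_sub_apply_biInter_le (μ k) (Finset.range (n + 1))
    (A := fun i => {φ | equivarianceDefect σ (e i) k φ < 1 / ((n : ℝ) + 1)})
    fun i _ => (isOpen_lt (continuous_equivarianceDefect σ (e i) k) continuous_const).measurableSet
  rw [← h2] at h3
  change 1 - ∑ i ∈ Finset.range (n + 1), _ ≤ _
  linarith

/-- A function bounded by `D` nearly attains its mean on a set of nearly full measure. -/
theorem ProbabilityMeasure.exists_mem_integral_le {Ω : Type*} [MeasurableSpace Ω]
    (μ : ProbabilityMeasure Ω) {A : Set Ω} (hA : MeasurableSet A) {f : Ω → ℝ}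
    (hf : Integrable f (μ : Measure Ω)) (hf0 : ∀ x, 0 ≤ f x) {D δ : ℝ} (hfD : ∀ x, f x ≤ D)
    (hD : 0 ≤ D) (hδ1 : δ ≤ 1) (hδ0 : 0 < δ) (hμ : 1 - δ < μ A) :
    ∃ x ∈ A, ∫ x, f x ∂(μ : Measure Ω) ≤ f x + (D + 1) * δ := by
  have hne : A.Nonempty := by
    by_contra hcon
    rw [Set.not_nonempty_iff_eq_empty.1 hcon, ProbabilityMeasure.coeFn_empty] at hμ
    rw [NNReal.coe_zero] at hμ
    linarith
  by_contra hcon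
  push Not at hcon
  -- If `f < c` on `A`, then `∫ f ≤ c + D * δ = ∫ f - δ`; the extra 1 in `D + 1` makes this a
  -- contradiction.
  set c := ∫ x, f x ∂(μ : Measure Ω) - (D + 1) * δ with hc
  have hc' : ∀ x ∈ A, f x < c := fun x hx => by have := hcon x hx; linarith
  obtain ⟨a, ha⟩ := hne
  have hc0 : 0 ≤ c := (hf0 a).trans (hc' a ha).le
  have hint : Integrable (fun x => c + D * Aᶜ.indicator (fun _ => (1 : ℝ)) x) (μ : Measure Ω) :=
    (integrable_const _).add (((integrable_const _).indicator hA.compl).const_mul D)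
  have h1 : ∫ x, f x ∂(μ : Measure Ω) ≤
      ∫ x, (c + D * Aᶜ.indicator (fun _ => (1 : ℝ)) x) ∂(μ : Measure Ω) := by
    refine integral_mono hf hint fun x => ?_
    by_cases hx : x ∈ A
    · simpa [hx] using (hc' x hx).le
    · simpa [hx] using (hfD x).trans (le_add_of_nonneg_left hc0)
  rw [integral_add (integrable_const _) (((integrable_const _).indicator hA.compl).const_mul D),
    integral_const_mul, integral_indicator_const _ hA.compl, probReal_compl_eq_one_sub hA] at h1
  have h2 : (μ : Measure Ω).real A = (μ A : ℝ) := rfl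
  simp only [integral_const, probReal_univ, h2, smul_eq_mul, mul_one] at h1
  have h3 : D * (1 - (μ A : ℝ)) ≤ D * δ := mul_le_mul_of_nonneg_left (by linarith) hD
  linarith

/-- Uniformity in A comes from a finite ε/3-net of the compact hyperspace, mean distance being
1-Lipschitz in A. It is needed because Y varies with k and j. -/
theorem eventually_meanDist_le (ν : ProbabilityMeasure X) {ε : ℝ} (hε : 0 < ε) :
    ∀ᶠ ν' : ProbabilityMeasure X in 𝓝 ν, ∀ A : NonemptyCompacts X,
      meanDist (ν : Measure X) A - meanDist (ν' : Measure X) A ≤ ε := by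
  obtain ⟨t, -, ht, hcov⟩ := finite_cover_balls_of_compact
    (isCompact_univ : IsCompact (Set.univ : Set (NonemptyCompacts X)))
    (by positivity : 0 < ε / 3)
  have hB : ∀ B ∈ t, ∀ᶠ ν' : ProbabilityMeasure X in 𝓝 ν,
      meanDist (ν : Measure X) B - ε / 3 < meanDist (ν' : Measure X) B := by
    intro B _
    have := ProbabilityMeasure.tendsto_iff_forall_integral_tendsto.1
      (tendsto_id (x := 𝓝 ν))
      (BoundedContinuousFunction.mkOfCompact ⟨_, Metric.continuous_infDist_pt (B : Set X)⟩)
    exact this.eventually (lt_mem_nhds (show meanDist (ν : Measure X) B - ε / 3 <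
      meanDist (ν : Measure X) B by linarith))
  filter_upwards [(eventually_all_finite ht).2 hB] with ν' hν' A
  obtain ⟨B, hBt, hAB⟩ := Set.mem_iUnion₂.1 (hcov (Set.mem_univ A))
  have h1 := meanDist_le_add_dist (ν : Measure X) A B
  have h2 := meanDist_le_add_dist (ν' : Measure X) B A
  have h3 := hν' B hBt
  rw [dist_comm] at h2
  rw [Metric.mem_ball] at hAB
  linarith

theorem LocallyWeakStarTendsto.tendsto_avg_meanDist
    {μ : ∀ k, ProbabilityMeasure (Fin (d k) → X)} {ν : ProbabilityMeasure X}
    (h : LocallyWeakStarTendsto μ ν) (Y : ∀ k, Fin (d k) → NonemptyCompacts X) {κ : ℕ → ℕ}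
    (hκ : Tendsto κ atTop atTop)
    (hY : Tendsto (fun l => avg fun j => meanDist (marginal (μ (κ l)) j : Measure X) (Y (κ l) j))
      atTop (𝓝 0)) :
    Tendsto (fun l => avg fun j => meanDist (ν : Measure X) (Y (κ l) j)) atTop (𝓝 0) := by
  obtain ⟨D, -, hD⟩ := exists_dist_le X
  rw [Metric.tendsto_nhds]
  intro ε hε
  have h1 := (h _ (eventually_meanDist_le ν (half_pos hε))).comp hκ
  have h2 := hY.add ((tendsto_const_nhds (x := ε / 2)).add
    (((tendsto_const_nhds (x := (1 : ℝ))).sub h1).const_mul D))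
  filter_upwards [h2.eventually (gt_mem_nhds (by linarith : 0 + (ε / 2 + D * (1 - 1)) < ε))]
    with l hl
  rw [Real.dist_eq, sub_zero, abs_of_nonneg (avg_nonneg fun j => meanDist_nonneg _ _)]
  refine lt_of_le_of_lt ?_ hl
  have h3 := avg_le_of_uniformProb (a := fun j => meanDist (ν : Measure X) (Y (κ l) j) -
      meanDist (marginal (μ (κ l)) j : Measure X) (Y (κ l) j)) (ε := ε / 2) (C := D)
    (s := {j | ∀ A : NonemptyCompacts X,
      meanDist (ν : Measure X) A - meanDist (marginal (μ (κ l)) j : Measure X) A ≤ ε / 2})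
    (fun j hj => hj _)
    (fun j => by
      have h4 := meanDist_le_of_dist_le (ν : Measure X) hD (Y (κ l) j)
      have h5 := meanDist_nonneg (marginal (μ (κ l)) j : Measure X) (Y (κ l) j)
      linarith)
  rw [avg_sub] at h3
  have h6 : avg (fun j => meanDist (ν : Measure X) (Y (κ l) j)) ≤
      avg (fun j => meanDist (marginal (μ (κ l)) j : Measure X) (Y (κ l) j)) + _ :=
    sub_le_iff_le_add'.1 h3
  exact h6

theorem integral_avg_infDist {k : ℕ} (μ : ProbabilityMeasure (Fin (d k) → X))
    (Y : Fin (d k) → NonemptyCompacts X) :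
    ∫ φ, avg (fun j => Metric.infDist (φ j) (Y j)) ∂(μ : Measure (Fin (d k) → X)) =
      avg fun j => meanDist (marginal μ j : Measure X) (Y j) := by
  have hc : ∀ j, Continuous fun x : X => Metric.infDist x (Y j : Set X) :=
    fun j => Metric.continuous_infDist_pt _
  simp only [avg]
  rw [integral_const_mul, integral_finsetSum
    (f := fun j (φ : Fin (d k) → X) => Metric.infDist (φ j) (Y j)) _ fun j _ =>
    integrable_of_continuous _ ((hc j).comp (continuous_apply j))]
  congr 1
  refine Finset.sum_congr rfl fun j _ => ?_
  have hmar : (marginal μ j : Measure X) =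
      (μ : Measure (Fin (d k) → X)).map fun φ => φ j := rfl
  rw [meanDist, hmar, integral_map (measurable_pi_apply j).aemeasurable
    (hc j).aestronglyMeasurable]

theorem eq_diracWhole_of_integral_meanDist_eq_zero [IsTopologicalGroup X] (ν : Measure X)
    [IsProbabilityMeasure ν] [ν.IsOpenPosMeasure] {η : ProbabilityMeasure (ClosedSubgroup X)}
    (h : ∫ K, meanDist ν (toNonemptyCompacts K) ∂(η : Measure (ClosedSubgroup X)) = 0) :
    η = diracWhole X := by
  have hf : Continuous fun K : ClosedSubgroup X => meanDist ν (toNonemptyCompacts K) :=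
    (continuous_meanDist ν).comp continuous_toNonemptyCompacts
  have hae := (integral_eq_zero_iff_of_nonneg (fun K => meanDist_nonneg ν _)
    (integrable_of_continuous (η : Measure (ClosedSubgroup X)) hf)).1 h
  have hw : ∀ᵐ K ∂(η : Measure (ClosedSubgroup X)), K = whole X := by
    filter_upwards [hae] with K hK
    refine toNonemptyCompacts_injective (eq_of_meanDist_le ν (Set.subset_univ _) ?_)
    have hK' : meanDist ν (toNonemptyCompacts K) = 0 := hK
    rw [hK']
    exact meanDist_nonneg ν _
  refine Subtype.ext (ext_of_forall_integral_eq_of_IsFiniteMeasure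
    (μ := (η : Measure (ClosedSubgroup X))) (ν := Measure.dirac (whole X)) fun f => ?_)
  rw [integral_dirac, integral_congr_ae (hw.mono fun K hK => by rw [hK] :
    (fun K => f K) =ᵐ[(η : Measure (ClosedSubgroup X))] fun _ => f (whole X))]
  simp

/-- Y is fixed before φ, so φ may be chosen adversarially: an approximate microstate nearly as far
from Y as the μ_k-average. The hypothesis applied to this one φ then controls all of μ_k along a
subsequence. -/
theorem eq_diracWhole_of_exists [IsTopologicalGroup X] [Countable G]
    {μ : ∀ k, ProbabilityMeasure (Fin (d k) → X)}
    (hμ : AsympSupportedOnTopMicrostates σ μ) (hμX : LocallyWeakStarTendsto μ (haarProb X))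
    {η : ProbabilityMeasure (ClosedSubgroup X)} (Y : ∀ k, Fin (d k) → ClosedSubgroup X)
    (hY : ∀ φ : ∀ k, Fin (d k) → X, IsTopMicrostates σ φ →
      ∃ κ : ℕ → ℕ, StrictMono κ ∧
        Tendsto (fun l => empirical (Y (κ l))) atTop (𝓝 η) ∧
        Tendsto (fun l => avg fun j =>
          Metric.infDist (φ (κ l) j) (Y (κ l) j : Set X)) atTop (𝓝 0)) :
    η = diracWhole X := by
  obtain ⟨e, he⟩ := exists_surjective_nat G
  obtain ⟨D, hDpos, hD⟩ := exists_dist_le X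
  have hD0 : 0 ≤ D := hDpos.le
  have hδ0 : ∀ n : ℕ, (0 : ℝ) < 1 / ((n : ℝ) + 1) := fun n => Nat.one_div_pos_of_nat
  obtain ⟨N, hN, hp⟩ := exists_tendsto_eventually_diagonal (l := atTop) le_rfl
    (p := fun n k => 1 - 1 / ((n : ℝ) + 1) < μ k (approxMicrostates σ e n k))
    fun n => (hμ.tendsto_approxMicrostates σ e n).eventually
      (lt_mem_nhds (sub_lt_self 1 (hδ0 n)))
  have hex : ∀ k, ∃ φ : Fin (d k) → X,
      1 - 1 / ((N k : ℝ) + 1) < μ k (approxMicrostates σ e (N k) k) →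
        φ ∈ approxMicrostates σ e (N k) k ∧
        ∫ φ, avg (fun j => Metric.infDist (φ j) (toNonemptyCompacts (Y k j)))
          ∂(μ k : Measure (Fin (d k) → X)) ≤
          avg (fun j => Metric.infDist (φ j) (toNonemptyCompacts (Y k j))) +
            (D + 1) * (1 / ((N k : ℝ) + 1)) := by
    intro k
    by_cases hk : 1 - 1 / ((N k : ℝ) + 1) < μ k (approxMicrostates σ e (N k) k)
    · have hc : Continuous fun φ : Fin (d k) → X =>
          avg fun j => Metric.infDist (φ j) (toNonemptyCompacts (Y k j)) := by
        unfold avg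
        exact continuous_const.mul (continuous_finsetSum _ fun j _ =>
          (Metric.continuous_infDist_pt _).comp (continuous_apply j))
      obtain ⟨φ, hφ, hle⟩ := ProbabilityMeasure.exists_mem_integral_le (μ k)
        (measurableSet_approxMicrostates σ e (N k) k) (integrable_of_continuous _ hc)
        (fun φ => avg_nonneg fun j => Metric.infDist_nonneg)
        (fun φ => (avg_mono fun j => (Metric.infDist_le_dist_of_mem
          (show (1 : X) ∈ (toNonemptyCompacts (Y k j) : Set X) from one_mem (Y k j))).trans
            (hD _ _)).trans (avg_const D).le)
        hD0 (by rw [div_le_one (by positivity)]; linarith [(N k).cast_nonneg (α := ℝ)])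
        (hδ0 (N k)) hk
      exact ⟨φ, fun _ => ⟨hφ, hle⟩⟩
    · exact ⟨1, fun h => absurd h hk⟩
  choose φ hφ using hex
  obtain ⟨κ, hκ, hη, hlim⟩ := hY φ (isTopMicrostates_of_tendsto_defect σ
    (tendsto_defect_of_mem_approxMicrostates σ he hN (hp.mono fun k hk => (hφ k hk).1)))
  have hκ' := hκ.tendsto_atTop
  have h1 : Tendsto (fun l => avg fun j => meanDist (marginal (μ (κ l)) j : Measure X)
      (toNonemptyCompacts (Y (κ l) j))) atTop (𝓝 0) := by
    have hsum := hlim.add (((tendsto_one_div_add_atTop_nhds_zero_nat (𝕜 := ℝ)).comp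
      (hN.comp hκ')).const_mul (D + 1))
    rw [mul_zero, add_zero] at hsum
    refine tendsto_of_tendsto_of_tendsto_of_le_of_le' tendsto_const_nhds hsum
      (Eventually.of_forall fun l => avg_nonneg fun j => meanDist_nonneg _ _) ?_
    filter_upwards [hκ'.eventually hp] with l hl
    rw [← integral_avg_infDist (μ (κ l)) fun j => toNonemptyCompacts (Y (κ l) j)]
    exact (hφ (κ l) hl).2
  -- Since most marginals are nearly Haar, they can be replaced by Haar measure itself.
  have h2 := hμX.tendsto_avg_meanDist (fun k j => toNonemptyCompacts (Y k j)) hκ' h1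
  have hf : Continuous fun K : ClosedSubgroup X =>
      meanDist (haarProb X : Measure X) (toNonemptyCompacts K) :=
    (continuous_meanDist _).comp continuous_toNonemptyCompacts
  have h3 := ProbabilityMeasure.tendsto_iff_forall_integral_tendsto.1 hη
    (BoundedContinuousFunction.mkOfCompact ⟨_, hf⟩)
  refine eq_diracWhole_of_integral_meanDist_eq_zero (haarProb X : Measure X)
    (tendsto_nhds_unique h3 (h2.congr fun l => ?_))
  exact (integral_empirical (Y (κ l)) hf.stronglyMeasurable).symm

end

theorem corollaryC {G X : Type*} [Group G] [Countable G]
    [Group X] [MetricSpace X] [CompactSpace X] [IsTopologicalGroup X]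
    [MeasurableSpace X] [BorelSpace X]
    [MulDistribMulAction G X] [ContinuousConstSMul G X]
    (d : ℕ → ℕ) [∀ k, NeZero (d k)] (σ : ∀ k, G → Equiv.Perm (Fin (d k)))
    (hσ : IsSoficApproximation d σ) :
    (¬ ∃ μ : ∀ k, ProbabilityMeasure (Fin (d k) → X),
        AsympSupportedOnTopMicrostates σ μ ∧ LocallyWeakStarTendsto μ (haarProb X)) ↔
      ∃ η : ProbabilityMeasure (ClosedSubgroup X),
        IsInvariantRandomSubgroup G η ∧ η ≠ diracWhole X ∧
        ∃ Y : ∀ k, Fin (d k) → ClosedSubgroup X,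
          ∀ φ : ∀ k, Fin (d k) → X, IsTopMicrostates σ φ →
            ∃ κ : ℕ → ℕ, StrictMono κ ∧
              Tendsto (fun l => empirical (Y (κ l))) atTop (𝓝 η) ∧
              Tendsto (fun l => (1 / (d (κ l) : ℝ)) *
                ∑ j, Metric.infDist (φ (κ l) j) (Y (κ l) j : Set X)) atTop (𝓝 0) := by
  refine ⟨exists_random_subgroup_of_not_exists σ, ?_⟩
  rintro ⟨η, -, hη, Y, hY⟩ ⟨μ, hμ, hμX⟩
  exact hη (eq_diracWhole_of_exists σ hμ hμX Y hY)
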